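/- For \(1\le p<\infty\) let \(X^p[0,1]=L^p[0,1]\) with its usual norm, and let \(X^\infty[0,1]=C[0,1]\) with the supremum norm. For \(\sigma:\mathbb{R}\to\mathbb{R}\) and \(n\in\mathbb{N}=\{1,2,\dots\}\) let \[\Phi_{n,\sigma}=\Big\{g:[0,1]\to\mathbb{R} : g(x)=\sum_{k=1}^n a_k\,\sigma(b_kx+c_k),\ a_k,b_k,c_k\in\mathbb{R}\Big\},\qquad E(\Phi_{n,\sigma},f)_p=\inf_{g\in\Phi_{n,\sigma}}\|f-g\|_{X^p[0,1]},\] where, for \(p<\infty\), only measurable \(g\) are considered, the norm is \(\infty\) if \(f-g\notin L^p[0,1]\), and for \(p=\infty\) the norm of \(f-g\) is \(\sup_{x\in[0,1]}|f(x)-g(x)|\in[0,\infty]\). For \(r\in\mathbb{N}\), \(h>0\) let \(\Delta_h^rf(x)=\sum_{j=0}^r(-1)^{r-j}\binom rj f(x+jh)\), and for \(0<\delta\le 1/r\) let \[\omega_r(f,\delta)_p=\sup_{0<h\le\delta}\Big(\int_0^{1-rh}|\Delta_h^rf(x)|^p\,dx\Big)^{1/p}\ (1\le p<\infty),\qquad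 \omega_r(f,\delta)_\infty=\sup_{0<h\le\delta}\ \sup_{x\in[0,1-rh]}|\Delta_h^rf(x)|.\] **Theorem.** For every \(r\in\mathbb{N}\) there is a constant \(C_r\), depending only on \(r\), such that the following holds. Let \(\sigma:\mathbb{R}\to\mathbb{R}\) be infinitely differentiable on some open interval (bounded or not) and let \(\sigma\) not coincide with a polynomial on that interval. Then for all \(1\le p\le\infty\), all \(f\in X^p[0,1]\) and all integers \(n\ge\max\{r,2\}\), \[E(\Phi_{n,\sigma},f)_p\le C_r\,\omega_r\!\left(f,\frac1n\right)_p .\] -/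

import Mathlib

open MeasureTheory Set
open scoped ENNReal NNReal

noncomputable section

namespace NeuralApprox

/-- Membership of `f` (only its values on `[0,1]` matter) in `X^p[0,1]`: this is `C[0,1]` for
`p = ∞`, and `L^p[0,1]` for finite `p`. -/
def MemX (p : ℝ≥0∞) (f : ℝ → ℝ) : Prop :=
  if p = ⊤ then ContinuousOn f (Icc 0 1) else MemLp f p (volume.restrict (Icc 0 1))

/-- The norm over the set `s`, with values in `[0,∞]`: the supremum of `|f x|` over all `x ∈ s`
for `p = ∞` (a genuine supremum, not an essential one; it is `∞` if `f` is unbounded on `s`), and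
`(∫_s |f|^p)^(1/p)` for finite `p`. -/
def xNorm (p : ℝ≥0∞) (s : Set ℝ) (f : ℝ → ℝ) : ℝ≥0∞ :=
  if p = ⊤ then ⨆ x ∈ s, ‖f x‖ₑ else eLpNorm f p (volume.restrict s)

/-- The set of functions on `[0,1]` of the form `x ↦ ∑ₖ aₖ σ(bₖ x + cₖ)` with `n` summands:
feedforward networks with one input, one output and one hidden layer of `n` neurons. -/
def networks (n : ℕ) (σ : ℝ → ℝ) : Set (ℝ → ℝ) :=
  {g | ∃ a b c : Fin n → ℝ, ∀ x ∈ Icc (0 : ℝ) 1, g x = ∑ k, a k * σ (b k * x + c k)}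

/-- The error of best approximation `inf {‖f - g‖ : g ∈ S}` in the norm of `X^p[0,1]`. For
finite `p` the norm is only meaningful for measurable functions (the lower integral behind
`eLpNorm` would be too small otherwise), so that only measurable `g` compete; for `p = ∞` every
`g ∈ S` competes, and an unbounded `f - g` contributes `∞`. -/
def bestApproxError (S : Set (ℝ → ℝ)) (p : ℝ≥0∞) (f : ℝ → ℝ) : ℝ≥0∞ :=
  ⨅ g ∈ {g ∈ S | p ≠ ⊤ → AEStronglyMeasurable g (volume.restrict (Icc 0 1))},
    xNorm p (Icc 0 1) (fun x => f x - g x)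

/-- The `r`-th modulus of smoothness `ω_r(f, δ)_p`: the supremum over `0 < h ≤ δ` of the norm over
`[0, 1 - r h]` of the `r`-th forward difference of `f` with step `h`. -/
def modulus (r : ℕ) (p : ℝ≥0∞) (f : ℝ → ℝ) (δ : ℝ) : ℝ≥0∞ :=
  ⨆ h ∈ Ioc (0 : ℝ) δ, xNorm p (Icc 0 (1 - r * h)) ((fwdDiff h)^[r] f)

end NeuralApprox

end

/-!
The constant comes from Jackson's theorem for algebraic polynomials; the activation function only
enters through the fact that the polynomials of degree less than `n` lie in the uniform closure of
the networks with `n` neurons.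

*From polynomials to networks.* Since `σ` is smooth and not a polynomial on `I`, its derivative of
order `n - 1` does not vanish identically on `I`, and shrinking the open set of non-vanishing
one order at a time yields a point `c ∈ I` at which no derivative of order less than `n` vanishes.
The `n` functions `x ↦ σ (k h x + c)`, `k < n`, have Taylor expansions in `h x`; inverting the
Vandermonde matrix of the nodes `k` produces coefficients that reproduce a prescribed polynomial up
to an error that tends to zero with `h` (`exists_network_near_polynomial`).

*Jackson's inequality for primitives.* On `[-1,1]` the unit step is approximated in `L¹` at the rate
`1 / (N + 1)` by polynomials of degree `N`: integrate the normalised fourth power of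
`T_M u / u`, where `T_M` is a Chebyshev polynomial of odd degree (`exists_polynomial_near_step`). As
a primitive of `w` is the convolution of `w` with the step, Young's inequality bounds its distance
to the polynomials of degree `N` by a multiple of `‖w‖_p / (N + 1)`. Iterating this gives
the rate `n ^ (-r)` for `r`-fold primitives (`IsIteratedPrimitive.exists_polynomial`).

*Smoothing.* Let `h = 1 / (2 n)` and let `τ` be the mean of `r` independent uniform variables on
`[0,1]`. The function `f` is compared with
`g x = ∑ j ∈ [1, r], (-1) ^ (j + 1) * (r choose j) * 𝔼 f (x + j h (τ - x))`. The step `h (τ - x)`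
points from `x` to another point of `[0,1]`, so that nothing is evaluated outside `[0,1]`. The
difference `f x - g x` is, up to sign, the mean of `Δ ^ r f x` with the random step `h (τ - x)`, and
exchanging the order of integration bounds its norm by the modulus of smoothness
(`eLpNorm_steklovDefect_le`). Each summand of `g` is a Steklov average evaluated at
`(1 - j h) x`; its `r`-th derivative is a multiple of an `r`-th difference of `f` with the step
`j h / r`, which is bounded by `h ^ (-r)` times the modulus.

The approximating polynomial does not depend on `p`, and neither does the constant. Thus the case
`p = ∞` follows from the finite exponents by letting `p` tend to infinity.
-/

namespace NeuralApprox

open Polynomial Topology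

/-! ### Polynomial approximation of the unit step -/

lemma exists_derivative_eq (q : ℝ[X]) (N : ℕ) (hq : q.degree < N) :
    ∃ Q : ℝ[X], derivative Q = q ∧ Q.degree < (N + 1 : ℕ) := by
  refine ⟨∑ k ∈ Finset.range N, C (q.coeff k / (k + 1)) * X ^ (k + 1), ?_, ?_⟩
  · rcases eq_or_ne q 0 with rfl | hq0
    · simp
    conv_rhs => rw [q.as_sum_range_C_mul_X_pow' ((natDegree_lt_iff_degree_lt hq0).2 hq)]
    rw [derivative_sum]
    refine Finset.sum_congr rfl fun k _ => ?_
    rw [derivative_C_mul_X_pow]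
    congr 2
    push_cast
    field_simp
  · refine (degree_sum_le _ _).trans_lt
      ((Finset.sup_lt_iff (WithBot.bot_lt_coe _)).2 fun k hk => ?_)
    refine (degree_C_mul_X_pow_le _ _).trans_lt ?_
    have := Finset.mem_range.1 hk
    exact_mod_cast Nat.succ_lt_succ this

/-- The quotient `sin ((2 m + 1) θ) / sin θ` is a polynomial in `sin θ`. -/
lemma exists_sin_odd_mul (m : ℕ) : ∃ R : ℝ[X], R.natDegree ≤ 2 * m ∧
    ∀ θ : ℝ, Real.sin θ * R.eval (Real.sin θ) = Real.sin ((2 * m + 1) * θ) := by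
  induction m using Nat.twoStepInduction with
  | zero => exact ⟨1, by simp, by simp⟩
  | one =>
    refine ⟨C 3 - C 4 * X ^ 2, by compute_degree, fun θ => ?_⟩
    have : ((2 * ((1 : ℕ) : ℝ) + 1) * θ) = 3 * θ := by push_cast; ring
    rw [this, Real.sin_three_mul]
    simp
    ring
  | more m h0 h1 =>
    obtain ⟨R0, d0, e0⟩ := h0
    obtain ⟨R1, d1, e1⟩ := h1
    refine ⟨(C 2 - C 4 * X ^ 2) * R1 - R0, ?_, fun θ => ?_⟩
    · refine (natDegree_sub_le _ _).trans (max_le ?_ (by omega))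
      refine natDegree_mul_le.trans ?_
      have : (C 2 - C 4 * X ^ 2 : ℝ[X]).natDegree ≤ 2 := by compute_degree
      omega
    · have h0 := e0 θ
      have h1 := e1 θ
      have hc : Real.cos (2 * θ) = 1 - 2 * Real.sin θ ^ 2 := by
        rw [Real.cos_two_mul, Real.cos_sq']; ring
      have a0 : (2 * (m : ℝ) + 1) * θ = (2 * ((m + 1 : ℕ) : ℝ) + 1) * θ - 2 * θ := by
        push_cast; ring
      have a2 : (2 * ((m + 2 : ℕ) : ℝ) + 1) * θ = (2 * ((m + 1 : ℕ) : ℝ) + 1) * θ + 2 * θ := by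
        push_cast; ring
      rw [a0, Real.sin_sub] at h0
      rw [a2, Real.sin_add]
      simp only [eval_sub, eval_mul, eval_C, eval_pow, eval_X]
      rw [hc] at h0 ⊢
      linear_combination (2 - 4 * Real.sin θ ^ 2) * h1 - h0

lemma abs_sin_odd_mul_le (m : ℕ) (θ : ℝ) :
    |Real.sin ((2 * m + 1) * θ)| ≤ (2 * m + 1) * |Real.sin θ| := by
  suffices h : ∀ k : ℕ, |Real.sin (k * θ)| ≤ k * |Real.sin θ| by simpa using h (2 * m + 1)
  intro k
  induction k with
  | zero => simp
  | succ k ih =>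
    have : ((k + 1 : ℕ) : ℝ) * θ = k * θ + θ := by push_cast; ring
    rw [this, Real.sin_add]
    refine (abs_add_le _ _).trans ?_
    rw [abs_mul, abs_mul]
    have h1 := Real.abs_cos_le_one θ
    have h2 := Real.abs_cos_le_one (k * θ)
    push_cast
    nlinarith [abs_nonneg (Real.sin θ), abs_nonneg (Real.sin (k * θ))]

/-- A polynomial that behaves like `min (2 m + 1) (1 / |u|)` on `[-1,1]`: up to sign it is the
quotient of the Chebyshev polynomial of degree `2 m + 1` by the variable. The value at `0` is left
out of the upper bound since only integrals of the polynomial matter. -/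
lemma exists_odd_chebyshev_quotient (m : ℕ) : ∃ R : ℝ[X], R.natDegree ≤ 2 * m ∧
    (∀ u ∈ Icc (-1 : ℝ) 1, |u * R.eval u| ≤ 1) ∧
    (∀ u ∈ Icc (-1 : ℝ) 1, u ≠ 0 → |R.eval u| ≤ 2 * m + 1) ∧
    (∀ u ∈ Ioc (0 : ℝ) (1 / (2 * m + 1)), (2 * m + 1 : ℝ) / 2 ≤ R.eval u) := by
  obtain ⟨R, hd, hR⟩ := exists_sin_odd_mul m
  have key : ∀ u ∈ Icc (-1 : ℝ) 1, u * R.eval u = Real.sin ((2 * m + 1) * Real.arcsin u) := by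
    intro u hu
    rw [← hR, Real.sin_arcsin hu.1 hu.2]
  refine ⟨R, hd, fun u hu => ?_, fun u hu hu0 => ?_, fun u hu => ?_⟩
  · rw [key u hu]
    exact Real.abs_sin_le_one _
  · have h := abs_sin_odd_mul_le m (Real.arcsin u)
    rw [← key u hu, abs_mul, Real.sin_arcsin hu.1 hu.2] at h
    have := abs_pos.2 hu0
    nlinarith
  · have hM : (0 : ℝ) < 2 * m + 1 := by positivity
    have hM1 : (1 : ℝ) ≤ 2 * m + 1 := by
      have : (0 : ℝ) ≤ m := by positivity
      linarith
    have hu1 : u ≤ 1 := hu.2.trans (by rw [div_le_one hM]; exact hM1)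
    have hmem : u ∈ Icc (-1 : ℝ) 1 := ⟨by linarith [hu.1], hu1⟩
    have hs := Real.sin_arcsin hmem.1 hmem.2
    have h0 : 0 ≤ Real.arcsin u := Real.arcsin_nonneg.2 hu.1.le
    have h1 := Real.mul_le_sin h0 (Real.arcsin_le_pi_div_two u)
    rw [hs] at h1
    have hpi := Real.pi_pos
    have hpi4 := Real.pi_le_four
    have h2 : Real.arcsin u ≤ Real.pi / 2 * u := by
      have : Real.arcsin u = Real.pi / 2 * (2 / Real.pi * Real.arcsin u) := by field_simp
      rw [this]
      gcongr
    have hle : (2 * m + 1) * Real.arcsin u ≤ Real.pi / 2 := by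
      have h3 : (2 * m + 1) * u ≤ 1 := by
        have := mul_le_mul_of_nonneg_left hu.2 hM.le
        rwa [mul_one_div_cancel hM.ne'] at this
      calc (2 * m + 1) * Real.arcsin u ≤ (2 * m + 1) * (Real.pi / 2 * u) := by gcongr
        _ = Real.pi / 2 * ((2 * m + 1) * u) := by ring
        _ ≤ Real.pi / 2 * 1 := by gcongr
        _ = _ := by ring
    have h4 := Real.mul_le_sin (mul_nonneg hM.le h0) hle
    rw [← key u hmem] at h4
    have h5 : u ≤ Real.arcsin u := by
      have := Real.sin_le h0
      rwa [hs] at this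
    have h6 : (1 : ℝ) / 2 ≤ 2 / Real.pi := by
      rw [div_le_div_iff₀ (by norm_num) hpi]; linarith
    have h7 : (1 / 2 : ℝ) * ((2 * m + 1) * u) ≤ u * R.eval u := by
      refine le_trans ?_ h4
      have := hu.1.le
      gcongr
    have := hu.1
    nlinarith

/-- A nonnegative polynomial kernel of degree at most `8 m` whose first absolute moment on `[-1,1]`,
relative to its total mass, is at most of order `1 / m`. The fourth power of the Chebyshev quotient is needed: the moment of the square
would carry a logarithm. -/
lemma exists_concentrated_kernel (m : ℕ) : ∃ q : ℝ[X], q.natDegree ≤ 8 * m ∧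
    (∀ u, 0 ≤ q.eval u) ∧ 0 < ∫ u in (-1 : ℝ)..1, q.eval u ∧
    (∫ u in (0 : ℝ)..1, u * q.eval u) ≤
      32 / (2 * m + 1) * ∫ u in (-1 : ℝ)..1, q.eval u ∧
    (∫ u in (-1 : ℝ)..0, -u * q.eval u) ≤
      32 / (2 * m + 1) * ∫ u in (-1 : ℝ)..1, q.eval u := by
  obtain ⟨R, hd, hR1, hR2, hR3⟩ := exists_odd_chebyshev_quotient m
  set M : ℝ := 2 * m + 1 with hMdef
  have hM1 : 1 ≤ M := by
    have : (0 : ℝ) ≤ m := by positivity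
    linarith
  have hM : 0 < M := by linarith
  have hcont : ∀ a b : ℝ, IntervalIntegrable (fun u => (R ^ 4).eval u) volume a b :=
    fun a b => (R ^ 4).continuous.intervalIntegrable a b
  have hnn : ∀ u, 0 ≤ (R ^ 4).eval u := fun u => by
    rw [eval_pow]; positivity
  have hlow : M ^ 3 / 16 ≤ ∫ u in (-1 : ℝ)..1, (R ^ 4).eval u := by
    have hM' : 1 / M ≤ 1 := by rw [div_le_one hM]; exact hM1
    have hM0 : 0 < 1 / M := by positivity
    calc M ^ 3 / 16 = ∫ u in (0 : ℝ)..(1 / M), (M / 2) ^ 4 := by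
          rw [intervalIntegral.integral_const]
          simp only [sub_zero, smul_eq_mul]
          field_simp
          norm_num
      _ ≤ ∫ u in (0 : ℝ)..(1 / M), (R ^ 4).eval u := by
          refine intervalIntegral.integral_mono_on_of_le_Ioo hM0.le (by simp) (hcont _ _) ?_
          intro u hu
          have := hR3 u ⟨hu.1, hu.2.le⟩
          rw [eval_pow]
          gcongr
      _ ≤ _ := intervalIntegral.integral_mono_interval (by norm_num) hM0.le hM'
          (Filter.Eventually.of_forall hnn) (hcont _ _)
  have hpt : ∀ u ∈ Icc (-1 : ℝ) 1, u ≠ 0 →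
      (R ^ 4).eval u ≤ 4 * M ^ 4 / (1 + M ^ 2 * u ^ 2) ^ 2 := by
    intro u hu hu0
    have h1 : (u * R.eval u) ^ 2 ≤ 1 := by
      rw [← sq_abs]; have := hR1 u hu; have := abs_nonneg (u * R.eval u); nlinarith
    have h2 : (R.eval u) ^ 2 ≤ M ^ 2 := by
      rw [← sq_abs]; have := hR2 u hu hu0; gcongr
    have h3 : R.eval u ^ 2 * (1 + M ^ 2 * u ^ 2) ≤ 2 * M ^ 2 := by
      nlinarith [sq_nonneg M]
    rw [le_div_iff₀ (by positivity), eval_pow]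
    calc R.eval u ^ 4 * (1 + M ^ 2 * u ^ 2) ^ 2 = (R.eval u ^ 2 * (1 + M ^ 2 * u ^ 2)) ^ 2 := by
          ring
      _ ≤ (2 * M ^ 2) ^ 2 := by gcongr
      _ = 4 * M ^ 4 := by ring
  have hderiv : ∀ u : ℝ, HasDerivAt (fun u => -(2 * M ^ 2) / (1 + M ^ 2 * u ^ 2))
      (u * (4 * M ^ 4 / (1 + M ^ 2 * u ^ 2) ^ 2)) u := by
    intro u
    have hne : 1 + M ^ 2 * u ^ 2 ≠ 0 := by positivity
    have h1 : HasDerivAt (fun u : ℝ => 1 + M ^ 2 * u ^ 2) (M ^ 2 * (2 * u)) u := by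
      simpa using ((hasDerivAt_pow 2 u).const_mul (M ^ 2)).const_add 1
    exact ((hasDerivAt_const u (-(2 * M ^ 2))).fun_div h1 hne).congr_deriv (by field_simp; ring)
  have hgc : Continuous fun u : ℝ => u * (4 * M ^ 4 / (1 + M ^ 2 * u ^ 2) ^ 2) := by
    refine continuous_id.mul (continuous_const.div (by fun_prop) fun u => by positivity)
  have hup : ∀ x : ℝ, x ≤ 2 * M ^ 2 →
      x ≤ 32 / M * ∫ u in (-1 : ℝ)..1, (R ^ 4).eval u := by
    intro x hx
    calc x ≤ 2 * M ^ 2 := hx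
      _ = 32 / M * (M ^ 3 / 16) := by field_simp; norm_num
      _ ≤ _ := by gcongr
  refine ⟨R ^ 4, ?_, hnn, lt_of_lt_of_le (by positivity) hlow, ?_, ?_⟩
  · exact natDegree_pow_le.trans (by omega)
  · refine hup _ ?_
    calc _ ≤ ∫ u in (0 : ℝ)..1, u * (4 * M ^ 4 / (1 + M ^ 2 * u ^ 2) ^ 2) := by
          refine intervalIntegral.integral_mono_on zero_le_one
            ((continuous_id.mul (R ^ 4).continuous).intervalIntegrable _ _)
            (hgc.intervalIntegrable _ _) fun u hu => ?_
          rcases hu.1.eq_or_lt with h | h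
          · simp [← h]
          · exact mul_le_mul_of_nonneg_left (hpt u ⟨by linarith, hu.2⟩ h.ne') hu.1
      _ = -(2 * M ^ 2) / (1 + M ^ 2 * 1 ^ 2) - -(2 * M ^ 2) / (1 + M ^ 2 * 0 ^ 2) :=
          intervalIntegral.integral_eq_sub_of_hasDerivAt (fun u _ => hderiv u)
            (hgc.intervalIntegrable _ _)
      _ ≤ 2 * M ^ 2 := by
          have : 0 ≤ 2 * M ^ 2 / (1 + M ^ 2 * 1 ^ 2) := by positivity
          rw [neg_div]
          norm_num at this ⊢
          linarith
  · refine hup _ ?_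
    calc _ ≤ ∫ u in (-1 : ℝ)..0, -(u * (4 * M ^ 4 / (1 + M ^ 2 * u ^ 2) ^ 2)) := by
          refine intervalIntegral.integral_mono_on (by norm_num)
            ((continuous_id.neg.mul (R ^ 4).continuous).intervalIntegrable _ _)
            (hgc.neg.intervalIntegrable _ _) fun u hu => ?_
          rcases hu.2.eq_or_lt with h | h
          · simp [h]
          · rw [← neg_mul]
            exact mul_le_mul_of_nonneg_left (hpt u ⟨hu.1, by linarith⟩ h.ne) (by linarith [hu.2])
      _ = -(-(2 * M ^ 2) / (1 + M ^ 2 * 0 ^ 2) - -(2 * M ^ 2) / (1 + M ^ 2 * (-1) ^ 2)) := by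
          rw [intervalIntegral.integral_neg]
          congr 1
          exact intervalIntegral.integral_eq_sub_of_hasDerivAt (fun u _ => hderiv u)
            (hgc.intervalIntegrable _ _)
      _ ≤ 2 * M ^ 2 := by
          have : 0 ≤ 2 * M ^ 2 / (1 + M ^ 2 * 1 ^ 2) := by positivity
          rw [neg_div, neg_div]
          norm_num at this ⊢
          linarith

/-- The unit step function on `[-1,1]` is approximated in `L¹` by polynomials of degree at most `N`
at the rate `1 / (N + 1)`. -/
lemma exists_polynomial_near_step (N : ℕ) : ∃ Q : ℝ[X], Q.natDegree ≤ N ∧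
    ∫⁻ v in Ioc (-1 : ℝ) 1, ‖(if 0 < v then 1 else 0) - Q.eval v‖ₑ ≤
      ENNReal.ofReal (576 / (N + 1)) := by
  rcases Nat.eq_zero_or_pos N with rfl | hN
  · refine ⟨0, by simp, ?_⟩
    calc _ ≤ ∫⁻ v in Ioc (-1 : ℝ) 1, (1 : ℝ≥0∞) := by
          refine lintegral_mono fun v => ?_
          simp only [eval_zero, sub_zero]
          split_ifs <;> simp
      _ ≤ _ := by
          simp only [lintegral_const, MeasurableSet.univ, Measure.restrict_apply, univ_inter,
            Real.volume_Ioc, one_mul]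
          apply ENNReal.ofReal_le_ofReal
          norm_num
  obtain ⟨q, hd, hq0, hI, hpos, hneg⟩ := exists_concentrated_kernel ((N - 1) / 8)
  set m := (N - 1) / 8 with hm
  set I := ∫ u in (-1 : ℝ)..1, q.eval u
  obtain ⟨Q₀, hQ₀, hdQ₀⟩ := exists_derivative_eq q (8 * m + 1)
    (degree_le_natDegree.trans_lt (by exact_mod_cast Nat.lt_succ_of_le hd))
  have hder : ∀ u : ℝ, HasDerivAt (fun u => Q₀.eval u) (q.eval u) u := fun u => by
    rw [← hQ₀]; exact Q₀.hasDerivAt u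
  have hint : ∀ a b : ℝ, ∫ u in a..b, q.eval u = Q₀.eval b - Q₀.eval a := fun a b =>
    intervalIntegral.integral_eq_sub_of_hasDerivAt (fun u _ => hder u)
      (q.continuous.intervalIntegrable a b)
  have hII : I = Q₀.eval 1 - Q₀.eval (-1) := hint _ _
  have hmono : ∀ a b : ℝ, a ≤ b → Q₀.eval a ≤ Q₀.eval b := fun a b hab => by
    have := intervalIntegral.integral_nonneg (μ := volume) hab fun u _ => hq0 u
    rw [hint] at this
    linarith
  set Q : ℝ[X] := C I⁻¹ * (Q₀ - C (Q₀.eval (-1))) with hQ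
  have hQe : ∀ v, Q.eval v = I⁻¹ * (Q₀.eval v - Q₀.eval (-1)) := fun v => by simp [hQ]
  have hQd : ∀ u : ℝ, HasDerivAt (fun u => Q.eval u) (I⁻¹ * q.eval u) u := fun u => by
    simp only [hQe]
    exact ((hder u).sub_const _).const_mul _
  have hQ1 : Q.eval 1 = 1 := by rw [hQe, ← hII, inv_mul_cancel₀ hI.ne']
  have hQm1 : Q.eval (-1) = 0 := by rw [hQe]; simp
  have hQmono : ∀ a b : ℝ, a ≤ b → Q.eval a ≤ Q.eval b := fun a b hab => by
    have := hmono a b hab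
    rw [hQe, hQe]
    gcongr
  -- Integration by parts turns the error on each side of `0` into a first moment of `q`.
  have hright : ∫ v in (0 : ℝ)..1, (1 - Q.eval v) ≤ 32 / (2 * m + 1) := by
    have h := intervalIntegral.integral_mul_deriv_eq_deriv_mul (a := 0) (b := 1)
      (u := fun v => 1 - Q.eval v) (v := fun v => v) (u' := fun v => -(I⁻¹ * q.eval v))
      (v' := fun _ => 1) (fun v _ => (hQd v).const_sub 1) (fun v _ => hasDerivAt_id v)
      (Continuous.intervalIntegrable (by fun_prop) _ _) (by simp)
    simp only [mul_one, hQ1, sub_self, mul_zero, zero_sub] at h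
    rw [h, ← intervalIntegral.integral_neg]
    calc _ = I⁻¹ * ∫ u in (0 : ℝ)..1, u * q.eval u := by
          rw [← intervalIntegral.integral_const_mul]
          congr 1; ext u; ring
      _ ≤ I⁻¹ * (32 / (2 * m + 1) * I) := by gcongr
      _ = _ := by field_simp
  have hleft : ∫ v in (-1 : ℝ)..0, Q.eval v ≤ 32 / (2 * m + 1) := by
    have h := intervalIntegral.integral_mul_deriv_eq_deriv_mul (a := -1) (b := 0)
      (u := fun v => Q.eval v) (v := fun v => v) (u' := fun v => I⁻¹ * q.eval v)
      (v' := fun _ => 1) (fun v _ => hQd v) (fun v _ => hasDerivAt_id v)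
      (Continuous.intervalIntegrable (by fun_prop) _ _) (by simp)
    simp only [mul_one, hQm1, mul_zero, zero_mul, sub_zero, zero_sub] at h
    rw [h, ← intervalIntegral.integral_neg]
    calc _ = I⁻¹ * ∫ u in (-1 : ℝ)..0, -u * q.eval u := by
          rw [← intervalIntegral.integral_const_mul]
          congr 1; ext u; ring
      _ ≤ I⁻¹ * (32 / (2 * m + 1) * I) := by gcongr
      _ = _ := by field_simp
  refine ⟨Q, ?_, ?_⟩
  · refine (natDegree_C_mul_le _ _).trans ((natDegree_sub_le _ _).trans (max_le ?_ (by simp)))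
    have : Q₀.natDegree ≤ 8 * m + 1 :=
      natDegree_le_of_degree_le (Order.le_of_lt_succ (by exact_mod_cast hdQ₀))
    omega
  · have hsplit : Ioc (-1 : ℝ) 1 = Ioc (-1) 0 ∪ Ioc 0 1 :=
      (Ioc_union_Ioc_eq_Ioc (by norm_num) (by norm_num)).symm
    have key : ∀ (a b : ℝ) (F : ℝ → ℝ), a ≤ b → Continuous F → (∀ v ∈ Ioc a b, 0 ≤ F v) →
        (∀ v ∈ Ioc a b, ‖(if 0 < v then 1 else 0) - Q.eval v‖ = F v) →
        (∫ v in a..b, F v) ≤ 32 / (2 * m + 1) →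
        ∫⁻ v in Ioc a b, ‖(if 0 < v then 1 else 0) - Q.eval v‖ₑ ≤
          ENNReal.ofReal (32 / (2 * m + 1)) := by
      intro a b F hab hF hF0 hFe hFi
      calc _ = ∫⁻ v in Ioc a b, ENNReal.ofReal (F v) := by
            refine setLIntegral_congr_fun measurableSet_Ioc fun v hv => ?_
            rw [← hFe v hv, ofReal_norm]
        _ = ENNReal.ofReal (∫ v in a..b, F v) := by
            rw [intervalIntegral.integral_of_le hab, ofReal_integral_eq_lintegral_ofReal]
            · exact (hF.intervalIntegrable a b).1
            · exact (ae_restrict_iff' measurableSet_Ioc).2 (Filter.Eventually.of_forall hF0)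
        _ ≤ _ := ENNReal.ofReal_le_ofReal hFi
    rw [hsplit]
    refine (lintegral_union_le _ _ _).trans ?_
    refine (add_le_add
      (key (-1) 0 (fun v => Q.eval v) (by norm_num) Q.continuous ?_ ?_ hleft)
      (key 0 1 (fun v => 1 - Q.eval v) (by norm_num) (by fun_prop) ?_ ?_ hright)).trans ?_
    · intro v hv
      have := hQmono (-1) v hv.1.le
      rwa [hQm1] at this
    · intro v hv
      have := hQmono (-1) v hv.1.le
      rw [hQm1] at this
      rw [if_neg (not_lt.2 hv.2), zero_sub, norm_neg, Real.norm_of_nonneg this]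
    · intro v hv
      have := hQmono v 1 hv.2
      rw [hQ1] at this
      linarith
    · intro v hv
      have := hQmono v 1 hv.2
      rw [hQ1] at this
      rw [if_pos hv.1, Real.norm_of_nonneg (by linarith)]
    · rw [← ENNReal.ofReal_add (by positivity) (by positivity)]
      apply ENNReal.ofReal_le_ofReal
      have h9 : (N : ℝ) + 1 ≤ 9 * (2 * m + 1) := by
        have : N + 1 ≤ 9 * (2 * m + 1) := by omega
        exact_mod_cast this
      rw [← add_div, div_le_div_iff₀ (by positivity) (by positivity)]
      linarith

/-! ### Jackson's inequality for iterated primitives -/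

/-- Jensen's inequality for `t ↦ t ^ p` and a finite measure. -/
lemma rpow_lintegral_le {α : Type*} [MeasurableSpace α] (μ : Measure α) [IsFiniteMeasure μ]
    {p : ℝ} (hp : 1 ≤ p) {F : α → ℝ≥0∞} (hF : AEMeasurable F μ) :
    (∫⁻ a, F a ∂μ) ^ p ≤ μ univ ^ (p - 1) * ∫⁻ a, F a ^ p ∂μ := by
  have hp0 : 0 < p := by linarith
  have h := eLpNorm'_le_eLpNorm'_mul_rpow_measure_univ one_pos hp hF.aestronglyMeasurable
  simp only [eLpNorm'_eq_lintegral_enorm, enorm_eq_self, ENNReal.rpow_one, div_one] at h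
  calc (∫⁻ a, F a ∂μ) ^ p
      ≤ ((∫⁻ a, F a ^ p ∂μ) ^ (1 / p) * μ univ ^ (1 - 1 / p)) ^ p := by gcongr
    _ = μ univ ^ (p - 1) * ∫⁻ a, F a ^ p ∂μ := by
      rw [ENNReal.mul_rpow_of_nonneg _ _ hp0.le, ← ENNReal.rpow_mul, ← ENNReal.rpow_mul,
        one_div_mul_cancel hp0.ne', ENNReal.rpow_one, mul_comm]
      congr 2
      field_simp

/-- Young's inequality `‖k * w‖_p ≤ ‖k‖_1 ‖w‖_p` on the line. -/
lemma lintegral_convolution_rpow_le {p : ℝ} (hp : 1 ≤ p) {k w : ℝ → ℝ≥0∞} (hk : Measurable k)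
    (hw : Measurable w) (hk' : ∫⁻ v, k v ≠ ∞) :
    ∫⁻ x, (∫⁻ t, k (x - t) * w t) ^ p ≤ (∫⁻ v, k v) ^ p * ∫⁻ t, w t ^ p := by
  have hp0 : 0 < p := by linarith
  set κ := ∫⁻ v, k v with hκ
  have hpt : ∀ x, (∫⁻ t, k (x - t) * w t) ^ p ≤ κ ^ (p - 1) * ∫⁻ t, k (x - t) * w t ^ p := by
    intro x
    have hkx : Measurable fun t => k (x - t) := hk.comp (measurable_const.sub measurable_id)
    -- Jensen's inequality for the measure with density `k (x - t)`, whose mass is `κ`.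
    set μ := (volume : Measure ℝ).withDensity fun t => k (x - t) with hμ
    have hmass : μ univ = κ := by
      rw [hμ, withDensity_apply _ MeasurableSet.univ, Measure.restrict_univ]
      exact lintegral_sub_left_eq_self k x
    have : IsFiniteMeasure μ := ⟨by rw [hmass]; exact hk'.lt_top⟩
    have h := rpow_lintegral_le μ hp hw.aemeasurable
    rwa [hmass, hμ, lintegral_withDensity_eq_lintegral_mul _ hkx hw,
      lintegral_withDensity_eq_lintegral_mul _ hkx (hw.pow_const p)] at h
  calc ∫⁻ x, (∫⁻ t, k (x - t) * w t) ^ p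
      ≤ ∫⁻ x, κ ^ (p - 1) * ∫⁻ t, k (x - t) * w t ^ p := lintegral_mono hpt
    _ = κ ^ (p - 1) * ∫⁻ x, ∫⁻ t, k (x - t) * w t ^ p := by
        rw [lintegral_const_mul' _ _ (ENNReal.rpow_ne_top_of_nonneg (by linarith) hk')]
    _ = κ ^ (p - 1) * ∫⁻ t, ∫⁻ x, k (x - t) * w t ^ p := by
        rw [lintegral_lintegral_swap]
        exact ((hk.comp (measurable_fst.sub measurable_snd)).mul
          ((hw.comp measurable_snd).pow_const p)).aemeasurable
    _ = κ ^ (p - 1) * ∫⁻ t, κ * w t ^ p := by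
        congr 1
        refine lintegral_congr fun t => ?_
        have hkt : Measurable fun x => k (x - t) := hk.comp (measurable_id.sub_const t)
        rw [lintegral_mul_const _ hkt,
          lintegral_sub_right_eq_self k t]
    _ = _ := by
        rw [lintegral_const_mul' _ _ hk', ← mul_assoc]
        congr 1
        nth_rewrite 2 [← ENNReal.rpow_one κ]
        rw [← ENNReal.rpow_add_of_nonneg _ _ (by linarith) zero_le_one, sub_add_cancel]

lemma exists_integral_comp_sub_polynomial (Q : ℝ[X]) {N : ℕ} (hQ : Q.natDegree ≤ N) {w : ℝ → ℝ}
    (hw : IntegrableOn w (Icc 0 1)) :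
    ∃ P : ℝ[X], P.degree < (N + 1 : ℕ) ∧
      ∀ x, P.eval x = ∫ t in Icc (0 : ℝ) 1, Q.eval (x - t) * w t := by
  refine ⟨∑ j ∈ Finset.range (N + 1),
    C (∫ t in Icc (0 : ℝ) 1, (hasseDeriv j Q).eval (-t) * w t) * X ^ j, ?_, fun x => ?_⟩
  · refine (degree_sum_le _ _).trans_lt
      ((Finset.sup_lt_iff (WithBot.bot_lt_coe _)).2 fun k hk => ?_)
    refine (degree_C_mul_X_pow_le _ _).trans_lt ?_
    exact_mod_cast Finset.mem_range.1 hk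
  · have hexp : ∀ t, Q.eval (x - t) =
        ∑ j ∈ Finset.range (N + 1), (hasseDeriv j Q).eval (-t) * x ^ j := fun t => by
      rw [sub_eq_add_neg, ← taylor_eval, eval_eq_sum_range' (n := N + 1)]
      · simp only [taylor_coeff]
      · rw [natDegree_taylor]; omega
    simp only [hexp, Finset.sum_mul, eval_finsetSum, eval_mul, eval_C, eval_pow, eval_X]
    rw [integral_finsetSum]
    · refine Finset.sum_congr rfl fun j _ => ?_
      rw [← integral_mul_const]
      congr 1; ext t; ring
    · intro j _
      exact IntegrableOn.continuousOn_mul (g := fun t => eval (-t) ((hasseDeriv j) Q) * x ^ j)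
        (by fun_prop) hw isCompact_Icc

lemma integral_eq_setIntegral_step {w : ℝ → ℝ} {x : ℝ} (hx : x ∈ Icc (0 : ℝ) 1) :
    ∫ t in (0 : ℝ)..x, w t = ∫ t in Icc (0 : ℝ) 1, (if 0 < x - t then 1 else 0) * w t := by
  have h1 : ∀ t, (if 0 < x - t then (1 : ℝ) else 0) * w t = (Iio x).indicator w t := fun t => by
    simp [indicator_apply]
  simp only [h1]
  rw [intervalIntegral.integral_of_le hx.1, setIntegral_indicator measurableSet_Iio,
    ← integral_Icc_eq_integral_Ioc, integral_Icc_eq_integral_Ico]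
  congr 2
  ext t
  simp only [mem_Ico, mem_inter_iff, mem_Icc, mem_Iio]
  constructor
  · rintro ⟨h, h'⟩; exact ⟨⟨h, by linarith [hx.2]⟩, h'⟩
  · rintro ⟨⟨h, _⟩, h'⟩; exact ⟨h, h'⟩

/-- Jackson's inequality for a single primitive; the polynomial does not depend on the exponent. -/
lemma exists_polynomial_near_primitive (N : ℕ) {w : ℝ → ℝ} (hwm : Measurable w)
    (hw : IntegrableOn w (Icc 0 1)) :
    ∃ P : ℝ[X], P.degree < (N + 1 : ℕ) ∧ ∀ p : ℝ≥0∞, 1 ≤ p → p ≠ ∞ →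
      eLpNorm (fun x => (∫ t in (0 : ℝ)..x, w t) - P.eval x) p (volume.restrict (Icc 0 1)) ≤
        ENNReal.ofReal (576 / (N + 1)) * eLpNorm w p (volume.restrict (Icc 0 1)) := by
  -- `P x = ∫ Q (x - t) w t dt` differs from the primitive by the convolution of `w` with the
  -- difference of the unit step and `Q`; as `x, t ∈ [0,1]`, only arguments in `[-1,1]` occur.
  obtain ⟨Q, hQd, hQ⟩ := exists_polynomial_near_step N
  obtain ⟨P, hPd, hP⟩ := exists_integral_comp_sub_polynomial Q hQd hw
  refine ⟨P, hPd, fun p hp1 hp => ?_⟩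
  set K : ℝ → ℝ := fun v => (if 0 < v then 1 else 0) - Q.eval v with hK
  have hKm : Measurable K :=
    (Measurable.ite measurableSet_Ioi measurable_const measurable_const).sub Q.continuous.measurable
  set k : ℝ → ℝ≥0∞ := (Icc (-1 : ℝ) 1).indicator fun v => ‖K v‖ₑ with hk
  have hkm : Measurable k := hKm.enorm.indicator measurableSet_Icc
  have hki : ∫⁻ v, k v ≤ ENNReal.ofReal (576 / (N + 1)) := by
    rw [hk, lintegral_indicator measurableSet_Icc, setLIntegral_congr Ioc_ae_eq_Icc.symm]
    exact hQ
  set W : ℝ → ℝ≥0∞ := (Icc (0 : ℝ) 1).indicator fun t => ‖w t‖ₑ with hW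
  have hWm : Measurable W := hwm.enorm.indicator measurableSet_Icc
  have hpt : ∀ x ∈ Icc (0 : ℝ) 1,
      ‖(∫ t in (0 : ℝ)..x, w t) - P.eval x‖ₑ ≤ ∫⁻ t, k (x - t) * W t := by
    intro x hx
    rw [hP, integral_eq_setIntegral_step hx, ← integral_sub]
    · refine (enorm_integral_le_lintegral_enorm _).trans ?_
      rw [← lintegral_indicator measurableSet_Icc]
      refine lintegral_mono fun t => ?_
      by_cases ht : t ∈ Icc (0 : ℝ) 1
      · have : x - t ∈ Icc (-1 : ℝ) 1 := ⟨by linarith [hx.1, ht.2], by linarith [hx.2, ht.1]⟩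
        simp only [hk, hW, indicator_of_mem ht, indicator_of_mem this]
        rw [← sub_mul, enorm_mul]
      · simp [ht]
    · refine hw.bdd_mul (c := 1) ?_ ?_
      · exact (Measurable.ite (measurableSet_lt measurable_const
          (measurable_const.sub measurable_id)) measurable_const
          measurable_const).aestronglyMeasurable
      · refine Filter.Eventually.of_forall fun t => ?_
        split_ifs <;> simp
    · exact IntegrableOn.continuousOn_mul (g := fun t => Q.eval (x - t)) (by fun_prop) hw
        isCompact_Icc
  have hp0 : p ≠ 0 := by
    rintro rfl; simp at hp1
  have hq : 1 ≤ p.toReal := by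
    rw [← ENNReal.toReal_one]; exact ENNReal.toReal_mono hp hp1
  have hq0 : 0 < p.toReal := by linarith
  rw [eLpNorm_eq_lintegral_rpow_enorm_toReal hp0 hp, eLpNorm_eq_lintegral_rpow_enorm_toReal hp0 hp]
  calc _ ≤ ((∫⁻ v, k v) ^ p.toReal * ∫⁻ t, W t ^ p.toReal) ^ (1 / p.toReal) := by
        gcongr
        refine le_trans ?_ (lintegral_convolution_rpow_le hq hkm hWm
          (hki.trans_lt ENNReal.ofReal_lt_top).ne)
        refine le_trans ?_ (setLIntegral_le_lintegral (Icc (0 : ℝ) 1) _)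
        refine setLIntegral_mono' measurableSet_Icc fun x hx => ?_
        gcongr
        exact hpt x hx
    _ = (∫⁻ v, k v) * (∫⁻ t in Icc (0 : ℝ) 1, ‖w t‖ₑ ^ p.toReal) ^ (1 / p.toReal) := by
        rw [ENNReal.mul_rpow_of_nonneg _ _ (by positivity), ← ENNReal.rpow_mul,
          mul_one_div_cancel hq0.ne', ENNReal.rpow_one, ← lintegral_indicator measurableSet_Icc]
        congr 3
        ext t
        by_cases ht : t ∈ Icc (0 : ℝ) 1
        · simp [hW, ht]
        · simp [hW, ht, hq0]
    _ ≤ _ := by gcongr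

/-- `IsIteratedPrimitive k G U` says that on `[0,1]` the function `G` arises from `U` by taking
primitives `k` times, with arbitrary constants of integration: `G` has the `k`-th derivative `U`
in the sense of Sobolev spaces. -/
def IsIteratedPrimitive : ℕ → (ℝ → ℝ) → (ℝ → ℝ) → Prop
  | 0, G, U => G = U
  | k + 1, G, U => ∃ G₁ : ℝ → ℝ, Measurable G₁ ∧ IntegrableOn G₁ (Icc 0 1) ∧
      IsIteratedPrimitive k G₁ U ∧ ∀ x ∈ Icc (0 : ℝ) 1, G x = G 0 + ∫ t in (0 : ℝ)..x, G₁ t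

/-- Jackson's inequality for `k`-fold primitives. -/
lemma IsIteratedPrimitive.exists_polynomial (m k : ℕ) {G U : ℝ → ℝ}
    (h : IsIteratedPrimitive k G U) :
    ∃ P : ℝ[X], P.degree < (m + k : ℕ) ∧ ∀ p : ℝ≥0∞, 1 ≤ p → p ≠ ∞ →
      eLpNorm (fun x => G x - P.eval x) p (volume.restrict (Icc 0 1)) ≤
        ENNReal.ofReal (576 / (m + 1)) ^ k * eLpNorm U p (volume.restrict (Icc 0 1)) := by
  induction k generalizing G with
  | zero =>
    cases h
    exact ⟨0, by simp [bot_lt_iff_ne_bot], fun p _ _ => by simp⟩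
  | succ k ih =>
    obtain ⟨G₁, hm, hi, hprim, hG⟩ := h
    obtain ⟨R, hRd, hR⟩ := ih hprim
    -- Subtracting a primitive `S` of `R` reduces the claim to a primitive of `G₁ - R`, for which
    -- the error already gained in approximating `G₁` by `R` is multiplied by one more factor.
    obtain ⟨S, hS, hSd⟩ := exists_derivative_eq R (m + k) hRd
    have hRi : ∀ a b : ℝ, IntervalIntegrable (fun t => R.eval t) volume a b :=
      fun a b => R.continuous.intervalIntegrable a b
    obtain ⟨P, hPd, hP⟩ := exists_polynomial_near_primitive (m + k) (w := fun t => G₁ t - R.eval t)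
      (hm.sub R.continuous.measurable) (hi.sub (R.continuous.integrableOn_Icc))
    have hconst : ∀ c : ℝ, (C c).degree < (m + (k + 1) : ℕ) := fun c =>
      degree_C_le.trans_lt (by exact_mod_cast Nat.succ_pos _)
    refine ⟨C (G 0 - S.eval 0) + S + P, ?_, fun p hp1 hp => ?_⟩
    · exact (degree_add_le _ _).trans_lt (max_lt ((degree_add_le _ _).trans_lt
        (max_lt (hconst _) hSd)) hPd)
    · have hcongr : ∀ x ∈ Icc (0 : ℝ) 1, G x - (C (G 0 - S.eval 0) + S + P).eval x =
          (∫ t in (0 : ℝ)..x, (G₁ t - R.eval t)) - P.eval x := by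
        intro x hx
        have hint : ∫ t in (0 : ℝ)..x, R.eval t = S.eval x - S.eval 0 :=
          intervalIntegral.integral_eq_sub_of_hasDerivAt
            (fun u _ => by rw [← hS]; exact S.hasDerivAt u) (hRi _ _)
        rw [intervalIntegral.integral_sub _ (hRi _ _), hint, hG x hx]
        · simp only [eval_add, eval_C]
          ring
        · rw [intervalIntegrable_iff_integrableOn_Icc_of_le hx.1]
          exact hi.mono_set (Icc_subset_Icc_right hx.2)
      rw [eLpNorm_congr_ae ((ae_restrict_iff' measurableSet_Icc).2
        (Filter.Eventually.of_forall hcongr))]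
      refine (hP p hp1 hp).trans ?_
      rw [pow_succ', mul_assoc]
      refine mul_le_mul' (ENNReal.ofReal_le_ofReal ?_) (hR p hp1 hp)
      have : (m : ℝ) ≤ (m + k : ℕ) := by exact_mod_cast Nat.le_add_right m k
      gcongr

/-! ### Steklov averages -/

/-- The law of the sum of `r` independent random variables that are uniform on `[0,1]`
(the Irwin–Hall distribution); its density is the cardinal B-spline of order `r`. -/
noncomputable def irwinHall : ℕ → Measure ℝ
  | 0 => Measure.dirac 0
  | r + 1 => Measure.conv (volume.restrict (Icc 0 1)) (irwinHall r)

instance : IsProbabilityMeasure (volume.restrict (Icc (0 : ℝ) 1)) := ⟨by simp⟩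

instance isProbabilityMeasure_irwinHall (r : ℕ) : IsProbabilityMeasure (irwinHall r) := by
  induction r with
  | zero => exact inferInstanceAs (IsProbabilityMeasure (Measure.dirac 0))
  | succ r ih => exact Measure.probabilitymeasure_of_probabilitymeasures_conv _ _

lemma irwinHall_succ (r : ℕ) :
    irwinHall (r + 1) = Measure.conv (volume.restrict (Icc 0 1)) (irwinHall r) := rfl

lemma irwinHall_compl_Icc (r : ℕ) : irwinHall r (Icc 0 (r : ℝ))ᶜ = 0 := by
  induction r with
  | zero => simp [irwinHall]
  | succ r ih =>
    have hm : MeasurableSet (Icc 0 ((r + 1 : ℕ) : ℝ))ᶜ := measurableSet_Icc.compl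
    rw [irwinHall_succ, ← lintegral_indicator_one hm,
      Measure.lintegral_conv (measurable_one.indicator hm)]
    rw [setLIntegral_congr_fun (g := 0) measurableSet_Icc]
    · simp
    · intro s hs
      simp only [Pi.zero_apply]
      have hms : Measurable fun t => (Icc 0 ((r + 1 : ℕ) : ℝ))ᶜ.indicator (1 : ℝ → ℝ≥0∞) (s + t) :=
        (measurable_one.indicator hm).comp (measurable_const_add s)
      rw [lintegral_eq_zero_iff hms]
      have : ∀ᵐ t ∂irwinHall r, t ∈ Icc 0 (r : ℝ) := by rwa [ae_iff]
      filter_upwards [this] with t ht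
      refine indicator_of_notMem ?_ _
      simp only [mem_compl_iff, not_not, mem_Icc]
      push_cast
      exact ⟨by linarith [hs.1, ht.1], by linarith [hs.2, ht.2]⟩

lemma irwinHall_succ_le_volume (r : ℕ) : irwinHall (r + 1) ≤ volume := by
  refine Measure.le_iff.2 fun A hA => ?_
  rw [irwinHall_succ, Measure.conv_comm, ← lintegral_indicator_one hA,
    Measure.lintegral_conv (measurable_one.indicator hA)]
  calc _ ≤ ∫⁻ t, volume A ∂irwinHall r := by
        refine lintegral_mono fun t => ?_
        refine (setLIntegral_le_lintegral _ _).trans ?_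
        rw [lintegral_add_left_eq_self (A.indicator 1) t, lintegral_indicator_one hA]
    _ = volume A := by simp

lemma irwinHall_le {r : ℕ} (hr : 1 ≤ r) : irwinHall r ≤ volume.restrict (Icc 0 (r : ℝ)) := by
  obtain ⟨r, rfl⟩ := Nat.exists_eq_add_of_le' hr
  have h : (irwinHall (r + 1)).restrict (Icc 0 ((r + 1 : ℕ) : ℝ)) = irwinHall (r + 1) :=
    Measure.restrict_eq_self_of_ae_mem (by
      have := irwinHall_compl_Icc (r + 1)
      rwa [ae_iff])
  rw [← h]
  exact Measure.restrict_mono le_rfl (irwinHall_succ_le_volume r)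

/-- The `r`-fold Steklov average of `f` with step `η`: the mean of `f` over `y + η t`, where `t` is
the sum of `r` independent uniform variables on `[0,1]`. -/
noncomputable def steklov (r : ℕ) (η : ℝ) (f : ℝ → ℝ) (y : ℝ) : ℝ :=
  ∫ t, f (y + η * t) ∂irwinHall r

@[simp] lemma steklov_zero_left (η : ℝ) (f : ℝ → ℝ) : steklov 0 η f = f := by
  ext y; simp [steklov, irwinHall]

lemma steklov_zero_step (r : ℕ) (f : ℝ → ℝ) : steklov r 0 f = f := by
  ext y; simp [steklov]

lemma measurable_steklov (r : ℕ) (η : ℝ) {f : ℝ → ℝ} (hf : Measurable f) :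
    Measurable (steklov r η f) := by
  have : Measurable (Function.uncurry fun y t : ℝ => f (y + η * t)) :=
    hf.comp (measurable_fst.add (measurable_snd.const_mul η))
  exact this.stronglyMeasurable.integral_prod_right.measurable

lemma integrable_comp_affine {f : ℝ → ℝ} (hf : Integrable f) (y : ℝ) {η : ℝ} (hη : η ≠ 0) :
    Integrable fun t => f (y + η * t) :=
  (hf.comp_add_left y).comp_mul_left' hη

lemma integrable_steklov_integrand (r : ℕ) {η : ℝ} (hη : η ≠ 0) {f : ℝ → ℝ} (hf : Integrable f)
    (y : ℝ) : Integrable (fun t => f (y + η * t)) (irwinHall r) := by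
  cases r with
  | zero => exact integrable_dirac (by simp [enorm_lt_top])
  | succ r => exact (integrable_comp_affine hf y hη).mono_measure (irwinHall_succ_le_volume r)

lemma integrable_steklov (r : ℕ) (η : ℝ) {f : ℝ → ℝ} (hfm : Measurable f) (hf : Integrable f) :
    Integrable (steklov r η f) := by
  have hm : Measurable fun z : ℝ × ℝ => f (z.1 + η * z.2) :=
    hfm.comp (measurable_fst.add (measurable_snd.const_mul η))
  have : Integrable (fun z : ℝ × ℝ => f (z.1 + η * z.2)) (volume.prod (irwinHall r)) := by
    rw [integrable_prod_iff' hm.aestronglyMeasurable]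
    refine ⟨Filter.Eventually.of_forall fun t => hf.comp_add_right (η * t), ?_⟩
    have : ∀ t, ∫ y, ‖f (y + η * t)‖ = ∫ y, ‖f y‖ := fun t =>
      integral_add_right_eq_self (fun y => ‖f y‖) (η * t)
    simp only [this]
    exact integrable_const _
  exact this.integral_prod_left

/-- The Irwin–Hall law is a convolution, so that the averages can be taken one at a time. -/
lemma steklov_succ (r : ℕ) {η : ℝ} (hη : 0 < η) {f : ℝ → ℝ} (hf : Integrable f) (y : ℝ) :
    steklov (r + 1) η f y = η⁻¹ * ∫ t in y..(y + η), steklov r η f t := by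
  have hi := integrable_steklov_integrand (r + 1) hη.ne' hf y
  rw [steklov, irwinHall_succ, integral_conv (by rwa [irwinHall_succ] at hi)]
  rw [integral_Icc_eq_integral_Ioc, ← intervalIntegral.integral_of_le zero_le_one]
  have h1 : ∀ s : ℝ, ∫ t, f (y + η * (s + t)) ∂irwinHall r = steklov r η f (y + η * s) := by
    intro s
    rw [steklov]
    congr 1; ext t; congr 1; ring
  simp only [h1]
  rw [intervalIntegral.integral_comp_add_mul (steklov r η f) hη.ne']
  simp

lemma steklov_const_mul_fwdDiff (r : ℕ) {η : ℝ} (hη : 0 < η) {f : ℝ → ℝ} (hf : Integrable f)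
    (c y : ℝ) : steklov r η (fun z => c * fwdDiff η f z) y = c * fwdDiff η (steklov r η f) y := by
  simp only [steklov, fwdDiff]
  rw [integral_const_mul, integral_sub]
  · congr 3; ext t; congr 1; ring
  · convert integrable_steklov_integrand r hη.ne' hf (y + η) using 3
    ring
  · exact integrable_steklov_integrand r hη.ne' hf y

/-- The dilated `r`-fold Steklov average has an `r`-th derivative, namely a rescaled `r`-th
difference. -/
lemma isIteratedPrimitive_steklov (r : ℕ) {η l : ℝ} (hη : 0 < η) (hl : 0 < l) {f : ℝ → ℝ}
    (hfm : Measurable f) (hf : Integrable f) :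
    IsIteratedPrimitive r (fun x => steklov r η f (l * x))
      (fun x => (l / η) ^ r * (fwdDiff η)^[r] f (l * x)) := by
  induction r generalizing f with
  | zero => simp [IsIteratedPrimitive]
  | succ r ih =>
    set f₁ : ℝ → ℝ := fun z => l / η * fwdDiff η f z with hf₁
    have hm₁ : Measurable f₁ :=
      ((hfm.comp (measurable_id.add_const η)).sub hfm).const_mul _
    have hi₁ : Integrable f₁ := ((hf.comp_add_right η).sub hf).const_mul _
    refine ⟨fun x => steklov r η f₁ (l * x), ?_, ?_, ?_, fun x hx => ?_⟩
    · exact (measurable_steklov r η hm₁).comp (measurable_const_mul l)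
    · exact ((integrable_steklov r η hm₁ hi₁).comp_mul_left' hl.ne').integrableOn
    · convert ih hm₁ hi₁ using 2 with x
      have : f₁ = (l / η) • fwdDiff η f := rfl
      rw [this, fwdDiff_iter_const_smul, Function.iterate_succ_apply, Pi.smul_apply, smul_eq_mul,
        pow_succ, mul_assoc]
    · have hS : ∀ a b, IntervalIntegrable (steklov r η f) volume a b := fun a b =>
        (integrable_steklov r η hfm hf).intervalIntegrable
      have hS' : ∀ a b, IntervalIntegrable (fun z => steklov r η f (z + η)) volume a b := fun a b =>
        ((integrable_steklov r η hfm hf).comp_add_right η).intervalIntegrable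
      have h1 : ∀ t, steklov r η f₁ (l * t) = l / η * fwdDiff η (steklov r η f) (l * t) :=
        fun t => steklov_const_mul_fwdDiff r hη hf _ _
      simp only [h1]
      rw [intervalIntegral.integral_const_mul,
        intervalIntegral.integral_comp_mul_left (fun z => fwdDiff η (steklov r η f) z) hl.ne',
        steklov_succ r hη hf, steklov_succ r hη hf]
      simp only [fwdDiff, mul_zero, zero_add, smul_eq_mul]
      rw [intervalIntegral.integral_sub (hS' _ _) (hS _ _),
        intervalIntegral.integral_comp_add_right (fun z => steklov r η f z), zero_add]
      have e1 := intervalIntegral.integral_add_adjacent_intervals (hS 0 η) (hS η (l * x + η))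
      have e2 := intervalIntegral.integral_add_adjacent_intervals (hS 0 (l * x))
        (hS (l * x) (l * x + η))
      have e3 : l / η * l⁻¹ = η⁻¹ := by field_simp
      rw [← mul_assoc, e3]
      linear_combination η⁻¹ * (e2 - e1)

/-! ### Smoothing and Jackson's theorem for finite exponents -/

lemma lintegral_comp_affine {g : ℝ → ℝ≥0∞} (hg : Measurable g) {a : ℝ} (ha : 0 < a) (b : ℝ) :
    ∫⁻ x, g (a * x + b) = ENNReal.ofReal a⁻¹ * ∫⁻ y, g y := by
  have hgb : Measurable fun y => g (y + b) := hg.comp (measurable_add_const b)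
  rw [← lintegral_map (f := fun y => g (y + b)) (g := fun x => a * x) hgb (measurable_const_mul a),
    Real.map_volume_mul_left ha.ne', lintegral_smul_measure, smul_eq_mul,
    lintegral_add_right_eq_self g b, abs_of_pos (inv_pos.2 ha)]

lemma one_le_toReal {p : ℝ≥0∞} (hp1 : 1 ≤ p) (hp : p ≠ ∞) : 1 ≤ p.toReal := by
  rw [← ENNReal.toReal_one]; exact ENNReal.toReal_mono hp hp1

lemma eLpNorm_rpow_toReal {α : Type*} [MeasurableSpace α] {p : ℝ≥0∞} (hp1 : 1 ≤ p) (hp : p ≠ ∞)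
    (F : α → ℝ) (μ : Measure α) : eLpNorm F p μ ^ p.toReal = ∫⁻ x, ‖F x‖ₑ ^ p.toReal ∂μ := by
  have hq := one_le_toReal hp1 hp
  rw [eLpNorm_eq_lintegral_rpow_enorm_toReal (by positivity) hp, ← ENNReal.rpow_mul,
    one_div_mul_cancel (by positivity), ENNReal.rpow_one]

lemma eLpNorm_real_const_mul {α : Type*} [MeasurableSpace α] (c : ℝ) (F : α → ℝ) (p : ℝ≥0∞)
    (μ : Measure α) : eLpNorm (fun x => c * F x) p μ = ‖c‖ₑ * eLpNorm F p μ :=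
  eLpNorm_const_smul c F p μ

lemma le_mul_of_rpow_le_mul_rpow {p : ℝ} (hp : 1 ≤ p) {c x A : ℝ≥0∞} (hc : 1 ≤ c)
    (h : x ^ p ≤ c * A ^ p) : x ≤ c * A := by
  have hp0 : 0 < p := by linarith
  rw [← ENNReal.rpow_le_rpow_iff hp0, ENNReal.mul_rpow_of_nonneg _ _ hp0.le]
  refine h.trans ?_
  gcongr
  nth_rewrite 1 [← ENNReal.rpow_one c]
  exact ENNReal.rpow_le_rpow_of_exponent_le hc hp

lemma eLpNorm_comp_mul_le {p : ℝ≥0∞} (hp1 : 1 ≤ p) (hp : p ≠ ∞) {F : ℝ → ℝ} (hF : Measurable F)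
    {l : ℝ} (hl : 1 / 2 ≤ l) :
    eLpNorm (fun x => F (l * x)) p (volume.restrict (Icc 0 1)) ≤
      2 * eLpNorm F p (volume.restrict (Icc 0 l)) := by
  have hl0 : 0 < l := by linarith
  refine le_mul_of_rpow_le_mul_rpow (one_le_toReal hp1 hp) (by norm_num) ?_
  rw [eLpNorm_rpow_toReal hp1 hp, eLpNorm_rpow_toReal hp1 hp]
  set g : ℝ → ℝ≥0∞ := (Icc 0 l).indicator fun y => ‖F y‖ₑ ^ p.toReal with hg
  have hgm : Measurable g := (hF.enorm.pow_const _).indicator measurableSet_Icc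
  calc ∫⁻ x in Icc 0 1, ‖F (l * x)‖ₑ ^ p.toReal = ∫⁻ x, g (l * x + 0) := by
        rw [← lintegral_indicator measurableSet_Icc]
        refine lintegral_congr fun x => ?_
        simp only [hg, indicator_apply, add_zero]
        refine if_congr ?_ rfl rfl
        simp only [mem_Icc]
        rw [mul_nonneg_iff_of_pos_left hl0, mul_le_iff_le_one_right hl0]
    _ = ENNReal.ofReal l⁻¹ * ∫⁻ y, g y := lintegral_comp_affine hgm hl0 0
    _ ≤ _ := by
        rw [hg, lintegral_indicator measurableSet_Icc]
        gcongr
        rw [← ENNReal.ofReal_ofNat 2]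
        apply ENNReal.ofReal_le_ofReal
        rw [inv_le_comm₀ hl0 (by norm_num)]
        linarith

lemma fwdDiff_neg_iter (r : ℕ) (s : ℝ) (f : ℝ → ℝ) (x : ℝ) :
    (fwdDiff (-s))^[r] f x = (-1) ^ r * (fwdDiff s)^[r] f (x - r * s) := by
  induction r generalizing f x with
  | zero => simp
  | succ r ih =>
    have h : fwdDiff (-s) f = (-1 : ℝ) • fun z => fwdDiff s f (z + -s) := by
      ext z; simp [fwdDiff]
    rw [Function.iterate_succ_apply, h, fwdDiff_iter_const_smul, Pi.smul_apply, ih,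
      fwdDiff_iter_comp_add, Function.iterate_succ_apply, smul_eq_mul, pow_succ]
    push_cast
    have : x - r * s + -s = x - (r + 1) * s := by ring
    rw [this]
    ring

lemma measurable_fwdDiff_iter (r : ℕ) {f : ℝ → ℝ} (hf : Measurable f) :
    Measurable fun z : ℝ × ℝ => (fwdDiff z.2)^[r] f z.1 := by
  simp only [fwdDiff_iter_eq_sum_shift, zsmul_eq_mul, nsmul_eq_mul]
  refine Finset.measurable_sum _ fun k _ => ?_
  exact measurable_const.mul (hf.comp (measurable_fst.add (measurable_snd.const_mul _)))

/-- The differences at `x ∈ [0,1]` whose step points to another point of `[0,1]`, scaled by `h`.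
Their mean over both points is controlled by the ordinary differences: with the step `s` as a new
variable, the points `x` that go with a given `s` stay inside the interval over which the modulus of
smoothness integrates. Negative steps are reduced to positive ones by a translation. -/
lemma lintegral_fwdDiff_toward_le {r : ℕ} (hr : 1 ≤ r) {p : ℝ≥0∞} (hp1 : 1 ≤ p) (hp : p ≠ ∞)
    {f : ℝ → ℝ} (hf : Measurable f) {h : ℝ} (hh : 0 < h) (hrh : r * h ≤ 1) {A : ℝ≥0∞}
    (hA : ∀ s ∈ Ioc (0 : ℝ) h,
      eLpNorm ((fwdDiff s)^[r] f) p (volume.restrict (Icc 0 (1 - r * s))) ≤ A) :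
    ∫⁻ x in Icc (0 : ℝ) 1, ∫⁻ t in Icc (0 : ℝ) r,
        ‖(fwdDiff (h * (t / r - x)))^[r] f x‖ₑ ^ p.toReal ≤ 2 * r * A ^ p.toReal := by
  have hr0 : (0 : ℝ) < r := by exact_mod_cast hr
  set Φ : ℝ → ℝ → ℝ≥0∞ := fun x s => ‖(fwdDiff s)^[r] f x‖ₑ ^ p.toReal with hΦ
  have hΦm : Measurable fun z : ℝ × ℝ => Φ z.1 z.2 :=
    (measurable_fwdDiff_iter r hf).enorm.pow_const _
  set S : Set (ℝ × ℝ) := {z | z.1 ∈ Icc (0 : ℝ) 1 ∧ z.1 + z.2 / h ∈ Icc (0 : ℝ) 1} with hS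
  have hSm : MeasurableSet S := by
    have h1 : Measurable fun z : ℝ × ℝ => z.1 + z.2 / h :=
      measurable_fst.add (measurable_snd.div_const h)
    exact (measurable_fst measurableSet_Icc).inter (h1 measurableSet_Icc)
  set Ψ : ℝ × ℝ → ℝ≥0∞ := S.indicator fun z => Φ z.1 z.2 with hΨ
  have hΨm : Measurable Ψ := hΦm.indicator hSm
  have hin : ∀ x ∈ Icc (0 : ℝ) 1, ∫⁻ t in Icc (0 : ℝ) r, Φ x (h * (t / r - x)) =
      ENNReal.ofReal (r / h) * ∫⁻ s, Ψ (x, s) := by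
    intro x hx
    have ha : 0 < h / r := by positivity
    have := lintegral_comp_affine (g := fun s => Ψ (x, s)) (hΨm.comp measurable_prodMk_left) ha
      (-(h * x))
    rw [inv_div] at this
    rw [← this, ← lintegral_indicator measurableSet_Icc]
    refine lintegral_congr fun t => ?_
    have e1 : h / r * t + -(h * x) = h * (t / r - x) := by ring
    rw [e1]
    simp only [hΨ, indicator_apply, hS, mem_ofPred_eq]
    refine if_congr ?_ rfl rfl
    have e2 : x + h * (t / r - x) / h = t / r := by field_simp; ring
    rw [e2]
    simp only [hx, true_and, mem_Icc]
    rw [div_le_one hr0, div_nonneg_iff]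
    constructor
    · exact fun ⟨h1, h2⟩ => ⟨Or.inl ⟨h1, hr0.le⟩, h2⟩
    · rintro ⟨h1 | h1, h2⟩
      · exact ⟨h1.1, h2⟩
      · linarith [h1.2]
  have hpos : ∀ s ∈ Ioc (0 : ℝ) h, ∫⁻ x, Ψ (x, s) ≤ A ^ p.toReal := by
    intro s hs
    have hsr : r * s ≤ s / h := by
      rw [le_div_iff₀ hh]; nlinarith [hs.1]
    calc ∫⁻ x, Ψ (x, s) ≤ ∫⁻ x in Icc 0 (1 - r * s), Φ x s := by
          rw [← lintegral_indicator measurableSet_Icc]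
          refine lintegral_mono fun x => ?_
          simp only [hΨ]
          by_cases hx : (x, s) ∈ S
          · have hx' : x ∈ Icc 0 (1 - r * s) :=
              ⟨hx.1.1, by have := hx.2.2; dsimp only at this; linarith⟩
            rw [indicator_of_mem hx, indicator_of_mem hx']
          · rw [indicator_of_notMem hx]; exact zero_le
      _ = eLpNorm ((fwdDiff s)^[r] f) p (volume.restrict (Icc 0 (1 - r * s))) ^ p.toReal := by
          rw [eLpNorm_rpow_toReal hp1 hp]
      _ ≤ _ := by gcongr; exact hA s hs
  have hneg : ∀ s ∈ Ioc (0 : ℝ) h, ∫⁻ x, Ψ (x, -s) ≤ A ^ p.toReal := by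
    intro s hs
    have hsr : r * s ≤ s / h := by
      rw [le_div_iff₀ hh]; nlinarith [hs.1]
    calc ∫⁻ x, Ψ (x, -s)
        ≤ ∫⁻ x, (Icc 0 (1 - r * s)).indicator (fun y => Φ y s) (x - r * s) := by
          refine lintegral_mono fun x => ?_
          simp only [hΨ]
          by_cases hx : (x, -s) ∈ S
          · have hx1 := hx.1.2
            have hx2 := hx.2.1
            rw [neg_div] at hx2
            dsimp only at hx1 hx2
            have hx' : x - r * s ∈ Icc 0 (1 - r * s) := ⟨by linarith, by linarith⟩
            rw [indicator_of_mem hx, indicator_of_mem hx']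
            simp only [hΦ]
            rw [fwdDiff_neg_iter, enorm_mul]
            simp
          · rw [indicator_of_notMem hx]; exact zero_le
      _ = ∫⁻ x in Icc 0 (1 - r * s), Φ x s := by
          rw [lintegral_sub_right_eq_self, lintegral_indicator measurableSet_Icc]
      _ = eLpNorm ((fwdDiff s)^[r] f) p (volume.restrict (Icc 0 (1 - r * s))) ^ p.toReal := by
          rw [eLpNorm_rpow_toReal hp1 hp]
      _ ≤ _ := by gcongr; exact hA s hs
  have hout : ∀ s, s ∉ Icc (-h) h → ∫⁻ x, Ψ (x, s) = 0 := by
    intro s hs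
    have : ∀ x, Ψ (x, s) = 0 := fun x => by
      refine indicator_of_notMem (fun hx => hs ?_) _
      obtain ⟨⟨h1, h2⟩, h3, h4⟩ := hx
      dsimp only at h1 h2 h3 h4
      have h5 : -1 ≤ s / h := by linarith
      have h6 : s / h ≤ 1 := by linarith
      rw [le_div_iff₀ hh] at h5
      rw [div_le_iff₀ hh] at h6
      exact ⟨by linarith, by linarith⟩
    simp [this]
  have hall : ∀ᵐ s : ℝ, ∫⁻ x, Ψ (x, s) ≤ (Icc (-h) h).indicator (fun _ => A ^ p.toReal) s := by
    filter_upwards [Measure.ae_ne volume (0 : ℝ)] with s hs0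
    by_cases hs : s ∈ Icc (-h) h
    · rw [indicator_of_mem hs]
      rcases lt_or_gt_of_ne hs0 with h0 | h0
      · have := hneg (-s) ⟨by linarith, by linarith [hs.1]⟩
        rwa [neg_neg] at this
      · exact hpos s ⟨h0, hs.2⟩
    · rw [hout s hs]; exact zero_le
  calc _ = ∫⁻ x in Icc (0 : ℝ) 1, ENNReal.ofReal (r / h) * ∫⁻ s, Ψ (x, s) :=
        setLIntegral_congr_fun measurableSet_Icc hin
    _ ≤ ∫⁻ x, ENNReal.ofReal (r / h) * ∫⁻ s, Ψ (x, s) := setLIntegral_le_lintegral _ _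
    _ = ENNReal.ofReal (r / h) * ∫⁻ s, ∫⁻ x, Ψ (x, s) := by
        rw [lintegral_const_mul' _ _ ENNReal.ofReal_ne_top, lintegral_lintegral_swap]
        exact hΨm.aemeasurable
    _ ≤ ENNReal.ofReal (r / h) * ∫⁻ s, (Icc (-h) h).indicator (fun _ => A ^ p.toReal) s := by
        gcongr 1
        exact lintegral_mono_ae hall
    _ = 2 * r * A ^ p.toReal := by
        rw [lintegral_indicator measurableSet_Icc, setLIntegral_const, Real.volume_Icc, mul_comm,
          mul_assoc, ← ENNReal.ofReal_mul (by linarith), mul_comm]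
        congr 1
        have : (h - -h) * (r / h) = 2 * r := by field_simp; ring
        rw [this, ENNReal.ofReal_mul (by norm_num)]
        simp

/-- The alternating sum, with binomial coefficients, of Steklov averages with the steps `j h / r`,
dilated by the factors `1 - j h`. Its term `j = 0` is `f` itself, so that it is the difference
between `f` and a smooth function. -/
noncomputable def steklovDefect (r : ℕ) (h : ℝ) (f : ℝ → ℝ) (x : ℝ) : ℝ :=
  ∑ j ∈ Finset.range (r + 1),
    (-1) ^ j * (r.choose j : ℝ) * steklov r (j * h / r) f ((1 - j * h) * x)

/-- The point `(1 - j h) x + (j h / r) t` equals `x + j s` with `s = h (t / r - x)`, a step that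
does not depend on `j`; this makes the alternating sum an average of `r`-th differences at `x`. -/
lemma steklovDefect_eq_integral {r : ℕ} (hr : 1 ≤ r) {h : ℝ} (hh : 0 < h) {f : ℝ → ℝ}
    (hf : Integrable f) (x : ℝ) :
    steklovDefect r h f x =
      (-1) ^ r * ∫ t, (fwdDiff (h * (t / r - x)))^[r] f x ∂irwinHall r := by
  have hr0 : (0 : ℝ) < r := by exact_mod_cast hr
  simp only [fwdDiff_iter_eq_sum_shift, zsmul_eq_mul, nsmul_eq_mul, steklovDefect, steklov]
  have harg : ∀ (j : ℕ) (t : ℝ),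
      x + j * (h * (t / r - x)) = (1 - j * h) * x + j * h / r * t := fun j t => by ring
  simp only [harg]
  rw [integral_finsetSum, Finset.mul_sum]
  · refine Finset.sum_congr rfl fun j hj => ?_
    rw [integral_const_mul, ← mul_assoc]
    congr 1
    push_cast
    have hjr : j ≤ r := Nat.lt_succ_iff.1 (Finset.mem_range.1 hj)
    rw [← mul_assoc, ← pow_add]
    congr 1
    have : r + (r - j) = j + 2 * (r - j) := by omega
    rw [this, pow_add, pow_mul]
    simp
  · intro j _
    refine Integrable.const_mul ?_ _
    rcases Nat.eq_zero_or_pos j with rfl | hj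
    · simp
    · have hj0 : (0 : ℝ) < j := by exact_mod_cast hj
      exact integrable_steklov_integrand r (by positivity) hf _

lemma eLpNorm_steklovDefect_le {r : ℕ} (hr : 1 ≤ r) {p : ℝ≥0∞} (hp1 : 1 ≤ p) (hp : p ≠ ∞)
    {f : ℝ → ℝ} (hfm : Measurable f) (hf : Integrable f) {h : ℝ} (hh : 0 < h) (hrh : r * h ≤ 1)
    {A : ℝ≥0∞} (hA : ∀ s ∈ Ioc (0 : ℝ) h,
      eLpNorm ((fwdDiff s)^[r] f) p (volume.restrict (Icc 0 (1 - r * s))) ≤ A) :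
    eLpNorm (steklovDefect r h f) p (volume.restrict (Icc 0 1)) ≤ 2 * r * A := by
  have hq := one_le_toReal hp1 hp
  refine le_mul_of_rpow_le_mul_rpow hq ?_ ?_
  · have : (1 : ℝ≥0∞) ≤ r := by exact_mod_cast hr
    calc (1 : ℝ≥0∞) = 1 * 1 := by simp
      _ ≤ (2 : ℝ≥0∞) * (r : ℝ≥0∞) := by gcongr; norm_num
  rw [eLpNorm_rpow_toReal hp1 hp]
  refine le_trans (lintegral_mono fun x => ?_)
    (lintegral_fwdDiff_toward_le hr hp1 hp hfm hh hrh hA)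
  have hm : Measurable fun t : ℝ => (fwdDiff (h * (t / r - x)))^[r] f x :=
    (measurable_fwdDiff_iter r hfm).comp
      (measurable_const.prodMk (((measurable_id.div_const (r : ℝ)).sub_const x).const_mul h))
  calc ‖steklovDefect r h f x‖ₑ ^ p.toReal
      ≤ (∫⁻ t, ‖(fwdDiff (h * (t / r - x)))^[r] f x‖ₑ ∂irwinHall r) ^ p.toReal := by
        gcongr
        rw [steklovDefect_eq_integral hr hh hf, enorm_mul]
        have : ‖(-1 : ℝ) ^ r‖ₑ = 1 := by simp
        rw [this, one_mul]
        exact enorm_integral_le_lintegral_enorm _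
    _ ≤ ∫⁻ t, ‖(fwdDiff (h * (t / r - x)))^[r] f x‖ₑ ^ p.toReal ∂irwinHall r := by
        have := rpow_lintegral_le (irwinHall r) hq hm.enorm.aemeasurable
        simpa using this
    _ ≤ _ := lintegral_mono' (irwinHall_le hr) le_rfl


/-- Jackson's inequality on `[0,1]`, with a polynomial that does not depend on the exponent. The
number `A` stands for the modulus of smoothness of order `r` at `1 / n`. -/
theorem exists_polynomial_jackson {r n : ℕ} (hr : 1 ≤ r) (hn : r ≤ n) {f : ℝ → ℝ}
    (hfm : Measurable f) (hf : Integrable f) :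
    ∃ P : ℝ[X], P.degree < n ∧ ∀ p : ℝ≥0∞, 1 ≤ p → p ≠ ∞ → ∀ A : ℝ≥0∞,
      (∀ s ∈ Ioc (0 : ℝ) (1 / n),
        eLpNorm ((fwdDiff s)^[r] f) p (volume.restrict (Icc 0 (1 - r * s))) ≤ A) →
      eLpNorm (fun x => f x - P.eval x) p (volume.restrict (Icc 0 1)) ≤
        (2 * r + ∑ j ∈ Finset.range r,
          (r.choose (j + 1) : ℝ≥0∞) * (2 * (1152 * r ^ 2) ^ r)) * A := by
  obtain ⟨m, rfl⟩ := Nat.exists_eq_add_of_le' hn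
  set n := m + r with hnm
  have hr0 : (0 : ℝ) < r := by exact_mod_cast hr
  have hn0 : (0 : ℝ) < n := by exact_mod_cast (by omega : 0 < n)
  have hrn : (r : ℝ) ≤ n := by exact_mod_cast hn
  -- With `1 / (2 n)` in place of `1 / n` the dilation factors `1 - j h` stay above `1 / 2`.
  set h : ℝ := 1 / (2 * n) with hh
  have hh0 : 0 < h := by positivity
  have hrh : r * h ≤ 1 / 2 := by
    rw [hh, mul_one_div, div_le_div_iff₀ (by positivity) (by norm_num)]; linarith
  have hhn : h ≤ 1 / n := by
    rw [hh]; apply one_div_le_one_div_of_le hn0; linarith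
  -- The `j`-th Steklov average, its step and its dilation factor; the index is shifted by one.
  set η : ℕ → ℝ := fun j => ((j + 1 : ℕ) : ℝ) * h / r with hη
  set l : ℕ → ℝ := fun j => 1 - ((j + 1 : ℕ) : ℝ) * h with hl
  have hη0 : ∀ j, 0 < η j := fun j => by positivity
  have hjr : ∀ j ∈ Finset.range r, ((j + 1 : ℕ) : ℝ) ≤ r := fun j hj => by
    exact_mod_cast Finset.mem_range.1 hj
  have hl2 : ∀ j ∈ Finset.range r, 1 / 2 ≤ l j := fun j hj => by
    have := mul_le_mul_of_nonneg_right (hjr j hj) hh0.le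
    simp only [hl]
    linarith
  have hex : ∀ j ∈ Finset.range r, ∃ P : ℝ[X], P.degree < n ∧ ∀ p : ℝ≥0∞, 1 ≤ p → p ≠ ∞ →
      eLpNorm (fun x => steklov r (η j) f (l j * x) - P.eval x) p (volume.restrict (Icc 0 1)) ≤
        ENNReal.ofReal (576 / (m + 1)) ^ r *
          eLpNorm (fun x => (l j / η j) ^ r * (fwdDiff (η j))^[r] f (l j * x)) p
            (volume.restrict (Icc 0 1)) := fun j hj =>
    (isIteratedPrimitive_steklov r (hη0 j) (by linarith [hl2 j hj]) hfm hf).exists_polynomial m r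
  choose! P hPd hP using hex
  set c : ℕ → ℝ := fun j => (-1) ^ (j + 1) * (r.choose (j + 1) : ℝ) with hc
  refine ⟨-∑ j ∈ Finset.range r, C (c j) * P j, ?_, fun p hp1 hp A hA => ?_⟩
  · rw [degree_neg]
    refine (degree_sum_le _ _).trans_lt
      ((Finset.sup_lt_iff (WithBot.bot_lt_coe _)).2 fun j hj => ?_)
    refine lt_of_le_of_lt ?_ (hPd j hj)
    rw [← smul_eq_C_mul]
    exact degree_smul_le _ _
  have hterm : ∀ j ∈ Finset.range r,
      eLpNorm (fun x => steklov r (η j) f (l j * x) - (P j).eval x) p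
        (volume.restrict (Icc 0 1)) ≤ 2 * (1152 * r ^ 2) ^ r * A := by
    intro j hj
    have hl1 : l j ≤ 1 := by simp only [hl]; linarith [show 0 ≤ ((j + 1 : ℕ) : ℝ) * h by positivity]
    have hlj := hl2 j hj
    have hj1 : (1 : ℝ) ≤ ((j + 1 : ℕ) : ℝ) := by exact_mod_cast Nat.succ_pos j
    have hηh : η j ≤ 1 / n := by
      refine le_trans ?_ hhn
      simp only [hη]
      rw [div_le_iff₀ hr0, mul_comm h]
      exact mul_le_mul_of_nonneg_right (hjr j hj) hh0.le
    have hlη : l j = 1 - r * η j := by simp only [hl, hη]; field_simp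
    have hU : eLpNorm (fun x => (l j / η j) ^ r * (fwdDiff (η j))^[r] f (l j * x)) p
        (volume.restrict (Icc 0 1)) ≤ ENNReal.ofReal (2 * n * r) ^ r * (2 * A) := by
      have hdm : Measurable ((fwdDiff (η j))^[r] f) :=
        (measurable_fwdDiff_iter r hfm).comp (measurable_id.prodMk measurable_const)
      rw [eLpNorm_real_const_mul, enorm_pow, Real.enorm_of_nonneg (by positivity)]
      gcongr
      · rw [div_le_iff₀ (hη0 j)]
        calc l j ≤ 1 := hl1
          _ ≤ ((j + 1 : ℕ) : ℝ) := hj1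
          _ = 2 * n * r * η j := by simp only [hη, hh]; field_simp
      · refine (eLpNorm_comp_mul_le hp1 hp hdm hlj).trans ?_
        gcongr
        rw [hlη]
        exact hA _ ⟨hη0 j, hηh⟩
    calc _ ≤ ENNReal.ofReal (576 / (m + 1)) ^ r * (ENNReal.ofReal (2 * n * r) ^ r * (2 * A)) :=
          (hP j hj p hp1 hp).trans (by gcongr)
      _ = ENNReal.ofReal (576 / (m + 1) * (2 * n * r)) ^ r * (2 * A) := by
          rw [← mul_assoc, ← mul_pow, ← ENNReal.ofReal_mul (by positivity)]
      _ ≤ (1152 * r ^ 2) ^ r * (2 * A) := by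
          gcongr
          calc ENNReal.ofReal (576 / (m + 1) * (2 * n * r)) ≤ ENNReal.ofReal (1152 * r ^ 2) := by
                apply ENNReal.ofReal_le_ofReal
                -- This is where `r ≤ n` enters: `n - r + 1` is at least `n / r`.
                have hmn : (n : ℝ) ≤ (m + 1) * r := by
                  have : n ≤ (m + 1) * r := by rw [hnm]; nlinarith
                  exact_mod_cast this
                rw [div_mul_eq_mul_div, div_le_iff₀ (by positivity)]
                nlinarith
            _ = 1152 * r ^ 2 := by
                rw [ENNReal.ofReal_mul (by norm_num), ENNReal.ofReal_pow hr0.le]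
                simp
      _ = _ := by ring
  have hsm : ∀ j, AEStronglyMeasurable
      (fun x => c j * (steklov r (η j) f (l j * x) - (P j).eval x))
      (volume.restrict (Icc (0 : ℝ) 1)) := fun j =>
    ((((measurable_steklov r _ hfm).comp (measurable_const_mul _)).sub
      (P j).continuous.measurable).const_mul _).aestronglyMeasurable
  have hdecomp : (fun x => f x - (-∑ j ∈ Finset.range r, C (c j) * P j).eval x) =
      steklovDefect r h f -
        ∑ j ∈ Finset.range r, fun x => c j * (steklov r (η j) f (l j * x) - (P j).eval x) := by
    ext x
    simp only [steklovDefect, Pi.sub_apply, Finset.sum_apply, eval_neg, eval_finsetSum, eval_mul,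
      eval_C]
    rw [Finset.sum_range_succ']
    simp only [mul_sub, Finset.sum_sub_distrib, hc, hη, hl]
    simp [steklov_zero_step]
  have hDm : AEStronglyMeasurable (steklovDefect r h f) (volume.restrict (Icc (0 : ℝ) 1)) := by
    refine (Finset.measurable_sum _ fun j _ => ?_).aestronglyMeasurable
    exact ((measurable_steklov r _ hfm).comp (measurable_const_mul _)).const_mul _
  rw [hdecomp, add_mul, Finset.sum_mul]
  refine (eLpNorm_sub_le hDm (Finset.aestronglyMeasurable_sum _ fun j _ => hsm j) hp1).trans ?_
  refine add_le_add ?_ ?_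
  · exact eLpNorm_steklovDefect_le hr hp1 hp hfm hf hh0 (by linarith) fun s hs =>
      hA s ⟨hs.1, hs.2.trans hhn⟩
  · refine (eLpNorm_sum_le (fun j _ => hsm j) hp1).trans (Finset.sum_le_sum fun j hj => ?_)
    rw [eLpNorm_real_const_mul, mul_assoc]
    have : ‖c j‖ₑ = r.choose (j + 1) := by
      simp only [hc]
      rw [enorm_mul]
      simp
    rw [this]
    gcongr
    exact hterm j hj

/-! ### Polynomials as limits of networks -/

lemma contDiffOn_deriv_of_isOpen {V : Set ℝ} (hV : IsOpen V) {σ : ℝ → ℝ}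
    (hσ : ContDiffOn ℝ ((⊤ : ℕ∞) : WithTop ℕ∞) σ V) :
    ContDiffOn ℝ ((⊤ : ℕ∞) : WithTop ℕ∞) (deriv σ) V :=
  hσ.deriv_of_isOpen hV (by simp)

lemma contDiffOn_iteratedDeriv {V : Set ℝ} (hV : IsOpen V) {σ : ℝ → ℝ}
    (hσ : ContDiffOn ℝ ((⊤ : ℕ∞) : WithTop ℕ∞) σ V) (n : ℕ) :
    ContDiffOn ℝ ((⊤ : ℕ∞) : WithTop ℕ∞) (iteratedDeriv n σ) V := by
  induction n with
  | zero => simpa using hσ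
  | succ n ih =>
    rw [iteratedDeriv_succ]
    exact contDiffOn_deriv_of_isOpen hV ih

lemma exists_polynomial_of_iteratedDeriv_eq_zero {I : Set ℝ} (hI : IsOpen I)
    (hIc : I.OrdConnected) (n : ℕ) {σ : ℝ → ℝ}
    (hσ : ContDiffOn ℝ ((⊤ : ℕ∞) : WithTop ℕ∞) σ I) (h : ∀ x ∈ I, iteratedDeriv n σ x = 0) :
    ∃ P : ℝ[X], ∀ x ∈ I, σ x = P.eval x := by
  induction n generalizing σ with
  | zero => exact ⟨0, fun x hx => by simpa using h x hx⟩
  | succ n ih =>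
    obtain ⟨R, hR⟩ := ih (contDiffOn_deriv_of_isOpen hI hσ) (by rwa [iteratedDeriv_succ'] at h)
    obtain ⟨S, hS, -⟩ := exists_derivative_eq R (R.natDegree + 1)
      (degree_le_natDegree.trans_lt (by exact_mod_cast Nat.lt_succ_self _))
    have hd : DifferentiableOn ℝ σ I := hσ.differentiableOn (by simp)
    obtain ⟨a, ha⟩ := hI.exists_is_const_of_deriv_eq_zero hIc.isPreconnected
      (f := fun x => σ x - S.eval x) (hd.sub S.differentiable.differentiableOn) fun x hx => by
        have h1 : DifferentiableAt ℝ σ x := (hd x hx).differentiableAt (hI.mem_nhds hx)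
        have h2 := h1.hasDerivAt.sub (S.hasDerivAt x)
        rw [hS, ← hR x hx, sub_self] at h2
        exact h2.deriv
    refine ⟨S + C a, fun x hx => ?_⟩
    have := ha x hx
    simp only [eval_add, eval_C]
    linarith

/-- If the derivative of order `n` does not vanish identically on an open set, then at some point of
that set no derivative of order at most `n` vanishes: where the derivative of order `n + 1` is
nonzero, the derivative of order `n` cannot vanish identically. -/
lemma exists_forall_iteratedDeriv_ne_zero {σ : ℝ → ℝ} (n : ℕ) {V : Set ℝ} (hV : IsOpen V)
    (hσ : ContDiffOn ℝ ((⊤ : ℕ∞) : WithTop ℕ∞) σ V) (h : ∃ x ∈ V, iteratedDeriv n σ x ≠ 0) :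
    ∃ c ∈ V, ∀ k ≤ n, iteratedDeriv k σ c ≠ 0 := by
  induction n generalizing V with
  | zero =>
    obtain ⟨x, hx, h⟩ := h
    exact ⟨x, hx, fun k hk => by rwa [Nat.le_zero.1 hk]⟩
  | succ n ih =>
    obtain ⟨x, hx, hne⟩ := h
    set W := V ∩ iteratedDeriv (n + 1) σ ⁻¹' {0}ᶜ with hW
    have hWo : IsOpen W :=
      (contDiffOn_iteratedDeriv hV hσ (n + 1)).continuousOn.isOpen_inter_preimage hV
        isOpen_compl_singleton
    have hxW : x ∈ W := ⟨hx, hne⟩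
    obtain ⟨c, hc, hcn⟩ := ih hWo (hσ.mono inter_subset_left) (by
      by_contra! hzero
      apply hne
      rw [iteratedDeriv_succ]
      have : iteratedDeriv n σ =ᶠ[𝓝 x] fun _ => 0 := by
        filter_upwards [hWo.mem_nhds hxW] with y hy using hzero y hy
      rw [this.deriv_eq]
      simp)
    refine ⟨c, hc.1, fun k hk => ?_⟩
    rcases hk.lt_or_eq with hk | rfl
    · exact hcn k (Nat.lt_succ_iff.1 hk)
    · exact hc.2

lemma exists_taylor_expansion {σ : ℝ → ℝ} {I : Set ℝ} (hI : IsOpen I) (hIc : I.OrdConnected)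
    (hσ : ContDiffOn ℝ ((⊤ : ℕ∞) : WithTop ℕ∞) σ I) {c : ℝ} (hc : c ∈ I) (N : ℕ) {ε : ℝ}
    (hε : 0 < ε) : ∃ δ > 0, ∀ y, |y| < δ → c + y ∈ I ∧
      |σ (c + y) - ∑ i ∈ Finset.range (N + 1), iteratedDeriv i σ c / i.factorial * y ^ i| ≤
        ε * |y| ^ N := by
  have h := (taylor_isLittleO (n := N) hIc.convex hc
    (hσ.of_le (by exact_mod_cast le_top))).bound hε
  rw [hI.nhdsWithin_eq hc] at h
  obtain ⟨δ, hδ, H⟩ := Metric.eventually_nhds_iff.1 (h.and (hI.mem_nhds hc))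
  refine ⟨δ, hδ, fun y hy => ?_⟩
  obtain ⟨h1, h2⟩ := @H (c + y) (by simpa [Real.dist_eq] using hy)
  refine ⟨h2, ?_⟩
  rw [taylor_within_apply] at h1
  simp only [add_sub_cancel_left, Real.norm_eq_abs, abs_pow, smul_eq_mul] at h1
  convert h1 using 3
  refine Finset.sum_congr rfl fun i _ => ?_
  rw [iteratedDerivWithin_of_isOpen hI hc]
  ring

/-- Polynomials of degree less than `n` lie in the uniform closure of the networks with `n`
neurons. -/
lemma exists_network_near_polynomial {σ : ℝ → ℝ} {I : Set ℝ} (hI : IsOpen I)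
    (hIc : I.OrdConnected) (hσ : ContDiffOn ℝ ((⊤ : ℕ∞) : WithTop ℕ∞) σ I)
    (hσP : ¬ ∃ P : ℝ[X], ∀ x ∈ I, σ x = P.eval x) {n : ℕ} {P : ℝ[X]} (hn : 1 ≤ n)
    (hP : P.degree < n) {ε : ℝ} (hε : 0 < ε) :
    ∃ g ∈ networks n σ, ContinuousOn g (Icc 0 1) ∧ ∀ x ∈ Icc (0 : ℝ) 1, |P.eval x - g x| ≤ ε := by
  obtain ⟨N, rfl⟩ := Nat.exists_eq_add_of_le' hn
  obtain ⟨c, hc, hcN⟩ := exists_forall_iteratedDeriv_ne_zero N hI hσ (by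
    by_contra! h
    exact hσP (exists_polynomial_of_iteratedDeriv_eq_zero hI hIc N hσ h))
  set V : Matrix (Fin (N + 1)) (Fin (N + 1)) ℝ :=
    Matrix.vandermonde fun k : Fin (N + 1) => ((k : ℕ) : ℝ) with hV
  have hVdet : IsUnit V.det := by
    rw [isUnit_iff_ne_zero, hV, Matrix.det_vandermonde_ne_zero_iff]
    intro i j hij
    exact Fin.ext (Nat.cast_injective hij)
  set d : Fin (N + 1) → ℝ := fun i =>
    P.coeff i * ((i : ℕ).factorial / iteratedDeriv i σ c) with hd
  set B : ℝ := ∑ k, ∑ i, |d i * V⁻¹ i k| with hB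
  have hB0 : 0 ≤ B := Finset.sum_nonneg fun k _ => Finset.sum_nonneg fun i _ => abs_nonneg _
  set ε' : ℝ := ε / (B * N ^ N + 1) with hε'
  have hBN : 0 < B * N ^ N + 1 := by positivity
  have hε'0 : 0 < ε' := by positivity
  obtain ⟨δ, hδ, hT⟩ := exists_taylor_expansion hI hIc hσ hc N hε'0
  set h : ℝ := min 1 (δ / (N + 1)) with hh
  have hh0 : 0 < h := by positivity
  have hh1 : h ≤ 1 := min_le_left _ _
  have hhδ : N * h < δ := by
    have h1 : h * (N + 1) ≤ δ := by
      rw [← le_div_iff₀ (by positivity)]; exact min_le_right _ _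
    nlinarith
  set a : Fin (N + 1) → ℝ := fun k => ∑ i, d i * V⁻¹ i k * (h ^ (i : ℕ))⁻¹ with ha
  -- The coefficients `a` have prescribed moments with respect to the nodes `k < N + 1`.
  have hmom : ∀ i : Fin (N + 1), ∑ k, a k * ((k : ℕ) : ℝ) ^ (i : ℕ) = d i * (h ^ (i : ℕ))⁻¹ := by
    intro i
    have hinv : V⁻¹ * V = 1 := Matrix.nonsing_inv_mul V hVdet
    calc ∑ k, a k * ((k : ℕ) : ℝ) ^ (i : ℕ)
        = ∑ k, ∑ j, d j * (h ^ (j : ℕ))⁻¹ * (V⁻¹ j k * V k i) := by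
          refine Finset.sum_congr rfl fun k _ => ?_
          rw [ha, Finset.sum_mul]
          refine Finset.sum_congr rfl fun j _ => ?_
          rw [hV, Matrix.vandermonde_apply]
          ring
      _ = ∑ j, d j * (h ^ (j : ℕ))⁻¹ * (V⁻¹ * V) j i := by
          rw [Finset.sum_comm]
          refine Finset.sum_congr rfl fun j _ => ?_
          rw [Matrix.mul_apply, Finset.mul_sum]
      _ = _ := by simp [hinv, Matrix.one_apply]
  have habs : ∀ k, |a k| ≤ (∑ i, |d i * V⁻¹ i k|) * (h ^ N)⁻¹ := by
    intro k
    rw [Finset.sum_mul]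
    refine (Finset.abs_sum_le_sum_abs _ _).trans (Finset.sum_le_sum fun i _ => ?_)
    rw [abs_mul, abs_of_pos (by positivity : 0 < (h ^ (i : ℕ))⁻¹)]
    refine mul_le_mul_of_nonneg_left ?_ (abs_nonneg _)
    exact inv_anti₀ (by positivity)
      (pow_le_pow_of_le_one hh0.le hh1 (Nat.lt_succ_iff.1 i.2))
  have hy : ∀ x ∈ Icc (0 : ℝ) 1, ∀ k : Fin (N + 1), 0 ≤ ((k : ℕ) : ℝ) * h * x ∧
      ((k : ℕ) : ℝ) * h * x ≤ N * h := by
    intro x hx k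
    have hx0 := hx.1
    have hk : ((k : ℕ) : ℝ) ≤ N := by exact_mod_cast Nat.lt_succ_iff.1 k.2
    refine ⟨by positivity, ?_⟩
    calc ((k : ℕ) : ℝ) * h * x ≤ N * h * 1 := by gcongr; exact hx.2
      _ = N * h := mul_one _
  have hyδ : ∀ x ∈ Icc (0 : ℝ) 1, ∀ k : Fin (N + 1), |((k : ℕ) : ℝ) * h * x| < δ := by
    intro x hx k
    rw [abs_of_nonneg (hy x hx k).1]
    exact (hy x hx k).2.trans_lt hhδ
  refine ⟨fun x => ∑ k, a k * σ (((k : ℕ) : ℝ) * h * x + c),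
    ⟨a, fun k => ((k : ℕ) : ℝ) * h, fun _ => c, fun x _ => rfl⟩, ?_, fun x hx => ?_⟩
  · refine continuousOn_finsetSum _ fun k _ => continuousOn_const.mul ?_
    refine hσ.continuousOn.comp (by fun_prop) fun x hx => ?_
    have := (hT _ (hyδ x hx k)).1
    rwa [add_comm] at this
  · -- The main terms of the Taylor expansions add up to `P` by the choice of the moments of `a`.
    have hmain : P.eval x = ∑ k, a k *
        ∑ i ∈ Finset.range (N + 1), iteratedDeriv i σ c / i.factorial *
          (((k : ℕ) : ℝ) * h * x) ^ i := by
      simp only [Finset.mul_sum]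
      rw [Finset.sum_comm, eval_eq_sum_range' (n := N + 1)
        (Nat.lt_succ_of_le
          (natDegree_le_of_degree_le (Order.le_of_lt_succ (by exact_mod_cast hP))))]
      refine Finset.sum_congr rfl fun i hi => ?_
      have hi' := Finset.mem_range.1 hi
      have hm := hmom ⟨i, hi'⟩
      have hne := hcN i (Nat.lt_succ_iff.1 hi')
      have hf : (i.factorial : ℝ) ≠ 0 := by exact_mod_cast i.factorial_ne_zero
      calc P.coeff i * x ^ i = iteratedDeriv i σ c / i.factorial * (h * x) ^ i *
            (d ⟨i, hi'⟩ * (h ^ i)⁻¹) := by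
            simp only [hd]
            rw [mul_pow]
            field_simp
        _ = _ := by
            rw [← hm, Finset.mul_sum]
            refine Finset.sum_congr rfl fun k _ => ?_
            simp only
            rw [mul_assoc ((k : ℕ) : ℝ) h x, mul_pow ((k : ℕ) : ℝ)]
            ring
    rw [hmain, ← Finset.sum_sub_distrib]
    calc |∑ k, (a k * ∑ i ∈ Finset.range (N + 1), iteratedDeriv i σ c / i.factorial *
              (((k : ℕ) : ℝ) * h * x) ^ i - a k * σ (((k : ℕ) : ℝ) * h * x + c))|
        ≤ ∑ k, (∑ i, |d i * V⁻¹ i k|) * (h ^ N)⁻¹ * (ε' * (N * h) ^ N) := by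
          refine (Finset.abs_sum_le_sum_abs _ _).trans (Finset.sum_le_sum fun k _ => ?_)
          rw [← mul_sub, abs_mul]
          refine mul_le_mul (habs k) ?_ (abs_nonneg _)
            (mul_nonneg (Finset.sum_nonneg fun i _ => abs_nonneg _) (by positivity))
          rw [abs_sub_comm, add_comm _ c]
          refine (hT _ (hyδ x hx k)).2.trans ?_
          rw [abs_of_nonneg (hy x hx k).1]
          exact mul_le_mul_of_nonneg_left (pow_le_pow_left₀ (hy x hx k).1 (hy x hx k).2 N) hε'0.le
      _ = ε' * (B * N ^ N) := by
          rw [← Finset.sum_mul, ← Finset.sum_mul, ← hB, mul_pow]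
          field_simp
      _ ≤ ε' * (B * N ^ N + 1) := by gcongr; linarith
      _ = ε := by rw [hε']; field_simp

/-! ### Jackson's theorem in the norms of the statement -/

/-- A bound on all `L^p` norms with finite `p` of a continuous function on `[0,1]` is a bound on its
supremum. -/
lemma enorm_le_of_forall_eLpNorm_le {φ : ℝ → ℝ} (hφ : ContinuousOn φ (Icc 0 1)) {A : ℝ≥0∞}
    (hA : ∀ p : ℝ≥0∞, 1 ≤ p → p ≠ ∞ → eLpNorm φ p (volume.restrict (Icc 0 1)) ≤ A) {x : ℝ}
    (hx : x ∈ Icc (0 : ℝ) 1) : ‖φ x‖ₑ ≤ A := by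
  by_contra! hlt
  obtain ⟨B, hAB, hBx⟩ := exists_between hlt
  have hB0 : B ≠ 0 := (zero_le.trans_lt hAB).ne'
  have hBtop : B ≠ ∞ := (hBx.trans_le le_top).ne
  have hev : ∀ᶠ y in 𝓝[Icc 0 1] x, B < ‖φ y‖ₑ :=
    (hφ.enorm x hx).eventually (lt_mem_nhds hBx)
  obtain ⟨W, hWo, hxW, hW⟩ := mem_nhdsWithin.1 hev
  set U := W ∩ Ioo (0 : ℝ) 1 with hU
  have hUo : IsOpen U := hWo.inter isOpen_Ioo
  have hUne : U.Nonempty := by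
    have : x ∈ closure (Ioo (0 : ℝ) 1) := by rwa [closure_Ioo zero_ne_one]
    exact mem_closure_iff.1 this W hWo hxW
  have hUpos : 0 < volume U := hUo.measure_pos volume hUne
  have hUB : ∀ y ∈ U, B ≤ ‖φ y‖ₑ := fun y hy => (hW ⟨hy.1, Ioo_subset_Icc_self hy.2⟩ : B < _).le
  have hUsub : U ⊆ Icc 0 1 := inter_subset_right.trans Ioo_subset_Icc_self
  -- Chebyshev's inequality with the exponent `k + 1`.
  have hk : ∀ k : ℕ, volume U ≤ (A / B) ^ (k + 1) := by
    intro k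
    have h1 : (1 : ℝ≥0∞) ≤ ((k + 1 : ℕ) : ℝ≥0∞) := by exact_mod_cast Nat.succ_pos k
    have h2 : ((k + 1 : ℕ) : ℝ≥0∞) ≠ ∞ := ENNReal.natCast_ne_top _
    have h := eLpNorm_rpow_toReal h1 h2 φ (volume.restrict (Icc 0 1))
    simp only [ENNReal.toReal_natCast, ENNReal.rpow_natCast] at h
    rw [div_eq_mul_inv, mul_pow, ← ENNReal.inv_pow, ← div_eq_mul_inv,
      ENNReal.le_div_iff_mul_le (Or.inl (pow_ne_zero _ hB0)) (Or.inl (ENNReal.pow_ne_top hBtop))]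
    calc volume U * B ^ (k + 1) = ∫⁻ _ in U, B ^ (k + 1) := by rw [setLIntegral_const, mul_comm]
      _ ≤ ∫⁻ y in U, ‖φ y‖ₑ ^ (k + 1) :=
          setLIntegral_mono' hUo.measurableSet fun y hy => by gcongr; exact hUB y hy
      _ ≤ ∫⁻ y in Icc (0 : ℝ) 1, ‖φ y‖ₑ ^ (k + 1) := lintegral_mono_set hUsub
      _ ≤ A ^ (k + 1) := by rw [← h]; gcongr; exact hA _ h1 h2
  have hlim := (ENNReal.tendsto_pow_atTop_nhds_zero_of_lt_one
    (ENNReal.div_lt_of_lt_mul (by rwa [one_mul]) : A / B < 1)).comp (Filter.tendsto_add_atTop_nat 1)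
  exact hUpos.not_ge (ge_of_tendsto' hlim hk)

/-- Differences only depend on the class of the function modulo null sets. -/
lemma fwdDiff_iter_ae_eq (r : ℕ) {s : ℝ} (hs : 0 ≤ s) {f g : ℝ → ℝ}
    (h : f =ᵐ[volume.restrict (Icc 0 1)] g) :
    (fwdDiff s)^[r] f =ᵐ[volume.restrict (Icc 0 (1 - r * s))] (fwdDiff s)^[r] g := by
  have h' : ∀ᵐ x : ℝ, x ∈ Icc (0 : ℝ) 1 → f x = g x := (ae_restrict_iff' measurableSet_Icc).1 h
  have hk : ∀ᵐ x : ℝ, ∀ k : ℕ, x + k * s ∈ Icc (0 : ℝ) 1 → f (x + k * s) = g (x + k * s) :=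
    ae_all_iff.2 fun k =>
      (measurePreserving_add_right volume ((k : ℝ) * s)).quasiMeasurePreserving.ae h'
  refine (ae_restrict_iff' measurableSet_Icc).2 ?_
  filter_upwards [hk] with x hx hmem
  simp only [fwdDiff_iter_eq_sum_shift, nsmul_eq_mul]
  refine Finset.sum_congr rfl fun k hkr => ?_
  have hkr' : (k : ℝ) ≤ r := by exact_mod_cast Nat.lt_succ_iff.1 (Finset.mem_range.1 hkr)
  have h0 : 0 ≤ (k : ℝ) * s := by positivity
  have h1 : (k : ℝ) * s ≤ r * s := by gcongr
  rw [hx k ⟨by linarith [hmem.1], by linarith [hmem.2]⟩]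

lemma MemX.integrableOn {p : ℝ≥0∞} (hp1 : 1 ≤ p) {f : ℝ → ℝ} (hf : MemX p f) :
    IntegrableOn f (Icc 0 1) := by
  rw [MemX] at hf
  split_ifs at hf with hp
  · exact hf.integrableOn_Icc
  · exact hf.integrable hp1

/-- The constant in Jackson's inequality with the modulus of smoothness of order `r`. -/
noncomputable def jacksonConst (r : ℕ) : ℝ≥0 :=
  2 * r + ∑ j ∈ Finset.range r, (r.choose (j + 1) : ℝ≥0) * (2 * (1152 * r ^ 2) ^ r)

/-- Jackson's inequality for all exponents; for `p = ∞` it is the limit of the inequalities with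
finite exponents, since the polynomial and the constant are independent of the exponent. -/
lemma exists_polynomial_xNorm_le {r n : ℕ} (hr : 1 ≤ r) (hn : r ≤ n) {p : ℝ≥0∞} (hp1 : 1 ≤ p)
    {f : ℝ → ℝ} (hf : MemX p f) :
    ∃ P : ℝ[X], P.degree < n ∧ xNorm p (Icc 0 1) (fun x => f x - P.eval x) ≤
      jacksonConst r * modulus r p f (1 / n) := by
  have hfi := hf.integrableOn hp1
  obtain ⟨g, hgm, hfg⟩ := hfi.1.aemeasurable
  -- A measurable and integrable function on the line that represents `f` on `[0,1]`.
  set G : ℝ → ℝ := (Icc (0 : ℝ) 1).indicator g with hG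
  have hGm : Measurable G := hgm.indicator measurableSet_Icc
  have hfG : f =ᵐ[volume.restrict (Icc 0 1)] G := by
    filter_upwards [hfg, ae_restrict_mem measurableSet_Icc] with x hx hxm
    rw [hG, indicator_of_mem hxm, hx]
  have hGi : Integrable G := (integrable_indicator_iff measurableSet_Icc).2 (hfi.congr hfg)
  obtain ⟨P, hPd, hP⟩ := exists_polynomial_jackson hr hn hGm hGi
  have hC : (2 * r + ∑ j ∈ Finset.range r, (r.choose (j + 1) : ℝ≥0∞) * (2 * (1152 * r ^ 2) ^ r)) =
      (jacksonConst r : ℝ≥0∞) := by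
    rw [jacksonConst]; push_cast; rfl
  have hkey : ∀ q : ℝ≥0∞, 1 ≤ q → q ≠ ∞ → ∀ A : ℝ≥0∞,
      (∀ s ∈ Ioc (0 : ℝ) (1 / n),
        eLpNorm ((fwdDiff s)^[r] f) q (volume.restrict (Icc 0 (1 - r * s))) ≤ A) →
      eLpNorm (fun x => f x - P.eval x) q (volume.restrict (Icc 0 1)) ≤ jacksonConst r * A := by
    intro q hq1 hq A hA
    have : (fun x => f x - P.eval x) =ᵐ[volume.restrict (Icc 0 1)] fun x => G x - P.eval x := by
      filter_upwards [hfG] with x hx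
      rw [hx]
    rw [eLpNorm_congr_ae this, ← hC]
    refine hP q hq1 hq A fun s hs => ?_
    rw [← eLpNorm_congr_ae (fwdDiff_iter_ae_eq r hs.1.le hfG)]
    exact hA s hs
  refine ⟨P, hPd, ?_⟩
  by_cases hp : p = ∞
  · subst hp
    have hfc : ContinuousOn f (Icc 0 1) := by simpa [MemX] using hf
    simp only [xNorm, modulus, if_true]
    refine iSup₂_le fun x hx => enorm_le_of_forall_eLpNorm_le
      (φ := fun x => f x - P.eval x) (hfc.sub P.continuous.continuousOn) (fun q hq1 hq => ?_) hx
    refine hkey q hq1 hq _ fun s hs => ?_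
    refine le_trans ?_ (le_iSup₂ s hs)
    set M := ⨆ x ∈ Icc (0 : ℝ) (1 - r * s), ‖(fwdDiff s)^[r] f x‖ₑ with hM
    refine (eLpNorm_le_of_ae_enorm_bound (C := M) ?_).trans ?_
    · filter_upwards [ae_restrict_mem measurableSet_Icc] with x hx
      exact le_iSup₂ (f := fun x (_ : x ∈ Icc (0 : ℝ) (1 - r * s)) => ‖(fwdDiff s)^[r] f x‖ₑ) x hx
    · have hs0 := hs.1
      have hvol : (volume.restrict (Icc (0 : ℝ) (1 - r * s))) univ ≤ 1 := by
        rw [Measure.restrict_apply_univ, Real.volume_Icc, ENNReal.ofReal_le_one]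
        have : 0 ≤ (r : ℝ) * s := by positivity
        linarith
      rw [smul_eq_mul]
      exact mul_le_of_le_one_right' (ENNReal.rpow_le_one hvol (inv_nonneg.2 ENNReal.toReal_nonneg))
  · simp only [xNorm, modulus, if_neg hp]
    exact hkey p hp1 hp _ fun s hs => le_iSup₂ (f := fun s (_ : s ∈ Ioc (0 : ℝ) (1 / n)) =>
      eLpNorm ((fwdDiff s)^[r] f) p (volume.restrict (Icc 0 (1 - r * s)))) s hs

lemma xNorm_sub_le {p : ℝ≥0∞} (hp1 : 1 ≤ p) {f P g : ℝ → ℝ} (hf : MemX p f)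
    (hP : Continuous P) (hg : ContinuousOn g (Icc 0 1)) {ε : ℝ≥0}
    (hPg : ∀ x ∈ Icc (0 : ℝ) 1, |P x - g x| ≤ ε) :
    xNorm p (Icc 0 1) (fun x => f x - g x) ≤ xNorm p (Icc 0 1) (fun x => f x - P x) + ε := by
  have hPg' : ∀ x ∈ Icc (0 : ℝ) 1, ‖P x - g x‖ₑ ≤ ε := fun x hx => by
    rw [Real.enorm_eq_ofReal_abs]
    exact ENNReal.ofReal_le_of_le_toReal (hPg x hx)
  have hsum : ∀ x, f x - g x = (f x - P x) + (P x - g x) := fun x => by ring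
  by_cases hp : p = ∞
  · simp only [xNorm, if_pos hp]
    refine iSup₂_le fun x hx => ?_
    rw [hsum]
    refine (enorm_add_le _ _).trans (add_le_add ?_ (hPg' x hx))
    exact le_iSup₂ (f := fun x (_ : x ∈ Icc (0 : ℝ) 1) => ‖f x - P x‖ₑ) x hx
  · simp only [xNorm, if_neg hp]
    have hgm : AEStronglyMeasurable g (volume.restrict (Icc 0 1)) :=
      hg.aestronglyMeasurable measurableSet_Icc
    have hPm : AEStronglyMeasurable P (volume.restrict (Icc 0 1)) := hP.aestronglyMeasurable
    simp only [hsum]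
    refine (eLpNorm_add_le ((hf.integrableOn hp1).1.sub hPm) (hPm.sub hgm) hp1).trans ?_
    refine add_le_add le_rfl ((eLpNorm_le_of_ae_enorm_bound (C := (ε : ℝ≥0∞)) ?_).trans ?_)
    · filter_upwards [ae_restrict_mem measurableSet_Icc] with x hx using hPg' x hx
    · simp

end NeuralApprox

theorem theorem2 (r : ℕ) (hr : 1 ≤ r) :
    ∃ C : ℝ≥0, ∀ (σ : ℝ → ℝ) (I : Set ℝ), IsOpen I → I.OrdConnected →
      ContDiffOn ℝ ((⊤ : ℕ∞) : WithTop ℕ∞) σ I →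
      (¬ ∃ P : Polynomial ℝ, ∀ x ∈ I, σ x = P.eval x) →
      ∀ p : ℝ≥0∞, 1 ≤ p → ∀ f : ℝ → ℝ, NeuralApprox.MemX p f →
      ∀ n : ℕ, max r 2 ≤ n →
        NeuralApprox.bestApproxError (NeuralApprox.networks n σ) p f
          ≤ (C : ℝ≥0∞) * NeuralApprox.modulus r p f (1 / (n : ℝ)) := by
  refine ⟨NeuralApprox.jacksonConst r, fun σ I hI hIc hσ hσP p hp1 f hf n hn => ?_⟩
  have hrn : r ≤ n := (le_max_left _ _).trans hn
  obtain ⟨P, hPd, hP⟩ := NeuralApprox.exists_polynomial_xNorm_le hr hrn hp1 hf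
  refine ENNReal.le_of_forall_pos_le_add fun ε hε _ => ?_
  obtain ⟨g, hg, hgc, hPg⟩ := NeuralApprox.exists_network_near_polynomial hI hIc hσ hσP
    (hr.trans hrn) hPd (NNReal.coe_pos.2 hε)
  calc NeuralApprox.bestApproxError (NeuralApprox.networks n σ) p f
      ≤ NeuralApprox.xNorm p (Icc 0 1) (fun x => f x - g x) :=
        iInf₂_le g ⟨hg, fun _ => hgc.aestronglyMeasurable measurableSet_Icc⟩
    _ ≤ NeuralApprox.xNorm p (Icc 0 1) (fun x => f x - P.eval x) + ε :=
        NeuralApprox.xNorm_sub_le hp1 hf P.continuous hgc hPg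
    _ ≤ _ := by gcongr
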